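/- Let $n\ge 0$ and let $\alpha_1,\dots,\alpha_n,\beta_1,\dots,\beta_n\in\mathbb C$ satisfy $\alpha_i-\beta_j\notin\mathbb Z$ for all $i,j$. Put $$\mathbf\Gamma(s)=\frac1{\prod_{i=1}^n\Gamma(s-\alpha_i+1)\,\prod_{i=1}^n\Gamma(-s+\beta_i+1)},\qquad D=z\frac{d}{dz},$$ and let $\mathcal H=\mathcal H_{(-1)^n}(\alpha_i,\beta_i)$ be the differential equation $$\Bigl((-1)^n\prod_{i=1}^n(D-\alpha_i)-z\prod_{j=1}^n(D-\beta_j)\Bigr)f=0.$$ Let $A_1,\dots,A_{n_A}$ be the distinct values among $e^{2\pi i\alpha_1},\dots,e^{2\pi i\alpha_n}$, let $m_{A_j}=\#\{k: e^{2\pi i\alpha_k}=A_j\}$, and let $\nu(A_j)$ be the element of minimal real part among the $\alpha_k$ with $e^{2\pi i\alpha_k}=A_j$. Similarly let $B_1,\dots,B_{n_B}$ be the distinct values among the $e^{2\pi i\beta_k}$, with multiplicities $m_{B_j}$, and let $\nu'(B_j)$ be the element of maximal real part among the $\beta_k$ with $e^{2\pi i\beta_k}=B_j$. Put $$S_{A_j,r}(z)=\sum_{l=0}^\infty\Bigl(\frac{\partial}{2\pi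 i\,\partial t}\Bigr)^r\Big|_{t=\nu(A_j)}\bigl(\mathbf\Gamma(l+t)\,z^{l+t}\bigr)\quad(0\le r<m_{A_j}),$$ $$S_{B_j,r}(z)=\sum_{l=0}^\infty\Bigl(\frac{\partial}{2\pi i\,\partial t}\Bigr)^r\Big|_{t=\nu'(B_j)}\bigl(\mathbf\Gamma(-l+t)\,z^{-l+t}\bigr)\quad(0\le r<m_{B_j}).$$ Let $D_{A,m_A}$ be the $n\times n$ matrix with rows and columns indexed by the pairs $(j,r)$, $0\le r<m_{A_j}$, whose entry at $(j,r),(j',r')$ is $\binom r{r'}A_j$ if $j=j'$ and $r'\le r$, and $0$ otherwise; $D_{B,m_B}$ is defined in the same way. A formal logarithmic series at $0$ (at $\infty$) is a formal sum $\sum_a z^a p_a(\log z)$, with $p_a\in\mathbb C[X]$ of bounded degree, in which $p_a\neq0$ only for $a$ in finitely many progressions $c+\mathbb Z_{\ge0}$ (respectively $c-\mathbb Z_{\ge 0}$), $c\in\mathbb C$. The local monodromy at $0$ is one positive turn around $0$, i.e. $\log z\mapsto\log z+2\pi i$; the local monodromy at $\infty$ is one positive turn around $\infty$, i.e. $\log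 z\mapsto\log z-2\pi i$. The matrix of a linear map has as its columns the coordinates of the images of the basis vectors. Then: 1. The formal series $S_{A_j,r}$ form a basis of the space of formal logarithmic series at $0$ that solve $\mathcal H$, and in this basis the local monodromy at $0$ is given by the matrix $D_{A,m_A}^{\,t}$. Moreover the series $S_{A_j,r}$ converge on the universal cover of $\{0<|z|<1\}$, and for every $0<\rho\le1$ their sums form a basis of the space of holomorphic solutions of $\mathcal H$ on the universal cover of $\{0<|z|<\rho\}$; in this basis the local monodromy at $0$ is given by $D_{A,m_A}^{\,t}$. 2. The formal series $S_{B_j,r}$ form a basis of the space of formal logarithmic series at $\infty$ that solve $\mathcal H$, and in this basis the local monodromy at $\infty$ is given by the matrix $(D_{B,m_B}^{\,t})^{-1}$. Moreover the series $S_{B_j,r}$ converge on the universal cover of $\{1<|z|<\infty\}$, and for every $R\ge1$ their sums form a basis of the space of holomorphic solutions of $\mathcal H$ on the universal cover of $\{R<|z|<\infty\}$; in this basis the local monodromy at $\infty$ is given by $(D_{B,m_B}^{\,t})^{-1}$. -/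

import Mathlib

open Polynomial TopologicalSpace

noncomputable section

namespace Hypergeom

/-! ### The balanced gamma product -/

/-- `𝚪(s) = 1 / (∏ Γ(s - α_i + 1) ∏ Γ(-s + β_i + 1))`. Mathlib's `Complex.Gamma` takes the value `0`
at its poles and `0⁻¹ = 0`, so that this is the usual entire function. -/
def gammaProd {n : ℕ} (α β : Fin n → ℂ) (s : ℂ) : ℂ :=
  ((∏ i, Complex.Gamma (s - α i + 1)) * ∏ i, Complex.Gamma (-s + β i + 1))⁻¹

/-- The number `2πi`. -/
def twoPiI : ℂ := 2 * (Real.pi : ℂ) * Complex.I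

/-! ### Exponents and indices -/

/-- The finite set of distinct values among `exp(2πi x_1), …, exp(2πi x_n)`. -/
def expValues {n : ℕ} (x : Fin n → ℂ) : Finset ℂ :=
  Finset.univ.image fun k => Complex.exp (twoPiI * x k)

/-- The multiplicity `m_A = #{k : exp(2πi x_k) = A}`. -/
def mult {n : ℕ} (x : Fin n → ℂ) (A : expValues x) : ℕ :=
  (Finset.univ.filter fun k => Complex.exp (twoPiI * x k) = A).card

/-- Pairs `(A, r)` with `A` one of the distinct values and `0 ≤ r < m_A`. -/
abbrev LocalIndex {n : ℕ} (x : Fin n → ℂ) : Type :=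
  Σ A : expValues x, Fin (mult x A)

theorem exists_min_re {n : ℕ} (x : Fin n → ℂ) (A : expValues x) :
    ∃ k, Complex.exp (twoPiI * x k) = A ∧
      ∀ k', Complex.exp (twoPiI * x k') = A → (x k).re ≤ (x k').re := by
  obtain ⟨k₀, -, hk₀⟩ := Finset.mem_image.1 A.2
  obtain ⟨k, hk, hmin⟩ := Finset.exists_min_image
    (Finset.univ.filter fun k => Complex.exp (twoPiI * x k) = A) (fun k => (x k).re)
    ⟨k₀, by simpa using hk₀⟩
  exact ⟨k, by simpa using hk, fun k' hk' => hmin k' (by simpa using hk')⟩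

theorem exists_max_re {n : ℕ} (x : Fin n → ℂ) (A : expValues x) :
    ∃ k, Complex.exp (twoPiI * x k) = A ∧
      ∀ k', Complex.exp (twoPiI * x k') = A → (x k').re ≤ (x k).re := by
  obtain ⟨k₀, -, hk₀⟩ := Finset.mem_image.1 A.2
  obtain ⟨k, hk, hmax⟩ := Finset.exists_max_image
    (Finset.univ.filter fun k => Complex.exp (twoPiI * x k) = A) (fun k => (x k).re)
    ⟨k₀, by simpa using hk₀⟩
  exact ⟨k, by simpa using hk, fun k' hk' => hmax k' (by simpa using hk')⟩

/-- The entry of `x` with `exp(2πi x_k) = A` of minimal real part (entries with the same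
exponential differ by integers, so its value is unique). -/
def nuMin {n : ℕ} (x : Fin n → ℂ) (A : expValues x) : ℂ :=
  x (exists_min_re x A).choose

/-- The entry of `x` with `exp(2πi x_k) = A` of maximal real part. -/
def nuMax {n : ℕ} (x : Fin n → ℂ) (A : expValues x) : ℂ :=
  x (exists_max_re x A).choose

/-- The block-diagonal matrix `D_{A,m}`, with entries `binom(r, r') A_j` for `j = j'`, `r' ≤ r`, and
`0` otherwise, where `A` runs over the distinct values `exp(2πi x_k)`. -/
def blockD {n : ℕ} (x : Fin n → ℂ) : Matrix (LocalIndex x) (LocalIndex x) ℂ :=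
  fun p q =>
    if p.1 = q.1 ∧ (q.2 : ℕ) ≤ (p.2 : ℕ) then ((p.2 : ℕ).choose (q.2 : ℕ) : ℂ) * (p.1 : ℂ) else 0

/-! ### The hypergeometric operator -/

section Operator

variable {M : Type*} [AddCommGroup M] [Module ℂ M]

/-- `(-1)^n ∏ (D - α_i) - z ∏ (D - β_j)`, acting on a space on which `D = z d/dz` and multiplication
by `z` act as linear endomorphisms `D` and `Z`. -/
def hypOp (D Z : Module.End ℂ M) {n : ℕ} (α β : Fin n → ℂ) : Module.End ℂ M :=
  ((-1 : ℂ) ^ n) • aeval D (∏ i, (X - C (α i))) - Z * aeval D (∏ j, (X - C (β j)))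

theorem hypOp_commute {D Z T : Module.End ℂ M} (hD : Commute T D) (hZ : Commute T Z)
    {n : ℕ} (α β : Fin n → ℂ) : Commute T (hypOp D Z α β) := by
  have key : ∀ p : ℂ[X], Commute T (aeval D p) := fun p => by
    induction p using Polynomial.induction_on' with
    | add p q hp hq => rw [map_add]; exact hp.add_right hq
    | monomial k c =>
      rw [aeval_monomial]
      have hc : Commute T (algebraMap ℂ (Module.End ℂ M) c) := (Algebra.commutes c T).symm
      exact hc.mul_right (hD.pow_right k)
  exact ((key _).smul_right _).sub_right (hZ.mul_right (key _))

theorem mem_ker_of_commute {T H : Module.End ℂ M} (h : Commute T H) :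
    ∀ x ∈ LinearMap.ker H, T x ∈ LinearMap.ker H := fun x hx => by
  have h' : T (H x) = H (T x) := LinearMap.congr_fun h.eq x
  rw [LinearMap.mem_ker] at hx ⊢
  rw [← h', hx, map_zero]

end Operator

/-! ### Formal logarithmic series

A formal series `∑ z^a p_a(log z)` is the family `a ↦ p_a` of polynomials (the variable `X` stands
for `log z`). The parameter `σ` is `1` for series at `0` and `-1` for series at `∞`. -/

/-- Formal logarithmic series at `0` (`σ = 1`), respectively at `∞` (`σ = -1`): the exponents lie in
finitely many progressions `c, c + σ, c + 2σ, …` and the degree in `log z` is bounded. -/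
def FormalLog (σ : ℤ) : Submodule ℂ (ℂ → ℂ[X]) where
  carrier := {f | ∃ (T : Finset ℂ) (N : ℕ), ∀ a, f a ≠ 0 →
    (∃ c ∈ T, ∃ l : ℕ, a = c + (σ : ℂ) * l) ∧ (f a).natDegree ≤ N}
  zero_mem' := ⟨∅, 0, fun a h => absurd rfl h⟩
  add_mem' := by
    rintro f g ⟨T, N, hf⟩ ⟨T', N', hg⟩
    refine ⟨T ∪ T', max N N', fun a h => ⟨?_, ?_⟩⟩
    · by_cases h0 : f a = 0
      · have h1 : g a ≠ 0 := fun h1 => h (by simp [h0, h1])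
        obtain ⟨c, hc, l, hl⟩ := (hg a h1).1
        exact ⟨c, Finset.mem_union_right _ hc, l, hl⟩
      · obtain ⟨c, hc, l, hl⟩ := (hf a h0).1
        exact ⟨c, Finset.mem_union_left _ hc, l, hl⟩
    · refine (natDegree_add_le _ _).trans (max_le_max ?_ ?_)
      · by_cases h0 : f a = 0
        · simp [h0]
        · exact (hf a h0).2
      · by_cases h0 : g a = 0
        · simp [h0]
        · exact (hg a h0).2
  smul_mem' := by
    rintro c f ⟨T, N, hf⟩
    refine ⟨T, N, fun a h => ?_⟩
    have h0 : f a ≠ 0 := fun h0 => h (by simp [h0])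
    exact ⟨(hf a h0).1, (natDegree_smul_le _ _).trans (hf a h0).2⟩

/-- `D = z d/dz`: it sends `z^a p(log z)` to `z^a (a p + p')(log z)`. -/
def formalD (σ : ℤ) : Module.End ℂ (FormalLog σ) where
  toFun f := ⟨fun a => a • f.1 a + derivative (f.1 a), by
    obtain ⟨T, N, hf⟩ := f.2
    refine ⟨T, N, fun a h => ?_⟩
    have h0 : f.1 a ≠ 0 := fun h0 => h (by simp [h0])
    refine ⟨(hf a h0).1, (natDegree_add_le _ _).trans (max_le ?_ ?_)⟩
    · exact (natDegree_smul_le _ _).trans (hf a h0).2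
    · exact (natDegree_derivative_le _).trans ((Nat.sub_le _ _).trans (hf a h0).2)⟩
  map_add' f g := by
    ext1; funext a
    simp only [Submodule.coe_add, Pi.add_apply, smul_add, map_add]
    abel
  map_smul' c f := by
    ext1; funext a
    simp only [Submodule.coe_smul, Pi.smul_apply, derivative_smul, RingHom.id_apply, smul_add]
    rw [smul_comm]

/-- Multiplication by `z`. -/
def formalZ (σ : ℤ) : Module.End ℂ (FormalLog σ) where
  toFun f := ⟨fun a => f.1 (a - 1), by
    obtain ⟨T, N, hf⟩ := f.2
    refine ⟨T.image (· + 1), N, fun a h => ⟨?_, (hf _ h).2⟩⟩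
    obtain ⟨c, hc, l, hl⟩ := (hf _ h).1
    exact ⟨c + 1, Finset.mem_image_of_mem _ hc, l, by linear_combination hl⟩⟩
  map_add' f g := rfl
  map_smul' c f := rfl

/-- `k`-fold continuation around `0` in the positive direction: `log z ↦ log z + 2πik`, and
`z^a ↦ exp(2πika) z^a`. -/
def formalDeck (σ k : ℤ) : Module.End ℂ (FormalLog σ) where
  toFun f := ⟨fun a => Complex.exp (twoPiI * k * a) • (f.1 a).comp (X + C (twoPiI * k)), by
    obtain ⟨T, N, hf⟩ := f.2
    refine ⟨T, N, fun a h => ?_⟩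
    have h0 : f.1 a ≠ 0 := fun h0 => h (by simp [h0])
    refine ⟨(hf a h0).1, (natDegree_smul_le _ _).trans ?_⟩
    rw [natDegree_comp, natDegree_X_add_C, mul_one]
    exact (hf a h0).2⟩
  map_add' f g := by
    ext1; funext a
    simp only [Submodule.coe_add, Pi.add_apply, smul_add, add_comp]
  map_smul' c f := by
    ext1; funext a
    simp only [Submodule.coe_smul, Pi.smul_apply, RingHom.id_apply, smul_comp]
    rw [smul_comm]

theorem formalDeck_commute_D (σ k : ℤ) : Commute (formalDeck σ k) (formalD σ) := by
  refine LinearMap.ext fun f => Subtype.ext (funext fun a => ?_)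
  simp [formalDeck, formalD, derivative_comp, smul_comp, smul_add, smul_comm a]

theorem formalDeck_commute_Z (σ k : ℤ) : Commute (formalDeck σ k) (formalZ σ) := by
  refine LinearMap.ext fun f => Subtype.ext (funext fun a => ?_)
  have h : Complex.exp (twoPiI * k * a) = Complex.exp (twoPiI * k * (a - 1)) := by
    rw [Complex.exp_eq_exp_iff_exists_int]
    exact ⟨k, by simp only [twoPiI]; ring⟩
  simp [formalDeck, formalZ, h]

/-- The formal solutions at `0` (`σ = 1`), respectively at `∞` (`σ = -1`). -/
def formalSolutions (σ : ℤ) {n : ℕ} (α β : Fin n → ℂ) : Submodule ℂ (FormalLog σ) :=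
  LinearMap.ker (hypOp (formalD σ) (formalZ σ) α β)

/-- The local monodromy on formal solutions: one positive turn around the point. A positive turn
around `∞` (`σ = -1`) is a negative turn around `0`. -/
def formalMonodromy (σ : ℤ) {n : ℕ} (α β : Fin n → ℂ) :
    Module.End ℂ (formalSolutions σ α β) :=
  (formalDeck σ σ).restrict (mem_ker_of_commute
    (hypOp_commute (formalDeck_commute_D σ σ) (formalDeck_commute_Z σ σ) α β))

/-- `(∂ / (2πi ∂s))^r (𝚪(s) z^s) = z^s · logCoeff α β r s (log z)`, expanded by the Leibniz rule. -/
def logCoeff {n : ℕ} (α β : Fin n → ℂ) (r : ℕ) (s : ℂ) : ℂ[X] :=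
  ∑ p ∈ Finset.range (r + 1),
    C ((twoPiI⁻¹) ^ r * (r.choose p : ℂ) * iteratedDeriv (r - p) (gammaProd α β) s) * X ^ p

open Classical in
/-- The formal series `∑_{l ≥ 0} (∂ / (2πi ∂t))^r |_{t = ν} (𝚪(σl + t) z^{σl + t})`. -/
def formalSeries (σ : ℤ) {n : ℕ} (α β : Fin n → ℂ) (ν : ℂ) (r : ℕ) : FormalLog σ :=
  ⟨fun a => if ∃ l : ℕ, a = ν + (σ : ℂ) * l then logCoeff α β r a else 0, by
    refine ⟨{ν}, r, fun a h => ?_⟩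
    have ha : ∃ l : ℕ, a = ν + (σ : ℂ) * l := by
      by_contra hne
      exact h (if_neg hne)
    refine ⟨⟨ν, Finset.mem_singleton_self ν, ha⟩, ?_⟩
    beta_reduce
    rw [if_pos ha]
    refine natDegree_sum_le_of_forall_le _ _ fun p hp => ?_
    exact (natDegree_C_mul_X_pow_le _ _).trans (Nat.lt_succ_iff.1 (Finset.mem_range.1 hp))⟩

/-! ### Holomorphic functions on logarithmic covers

For an open `V ⊆ ℂ`, a multivalued function on `V \ {0}` is a function of `u = log z` on
`{u | exp u ∈ V}`; there `D = z d/dz` is `d/du`. -/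

/-- The cover `{u | exp u ∈ V}` of `V \ {0}`. It is the universal cover if `V` is a punctured disc
at `0` or at `∞`. -/
def logCover (V : Opens ℂ) : Opens ℂ :=
  ⟨Complex.exp ⁻¹' V, V.2.preimage Complex.continuous_exp⟩

theorem logCover_add (V : Opens ℂ) (k : ℤ) (u : ℂ) :
    u + twoPiI * k ∈ logCover V ↔ u ∈ logCover V := by
  have h : Complex.exp (u + twoPiI * k) = Complex.exp u := by
    rw [Complex.exp_eq_exp_iff_exists_int]
    exact ⟨k, by simp only [twoPiI]; ring⟩
  change Complex.exp (u + twoPiI * k) ∈ V ↔ Complex.exp u ∈ V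
  rw [h]

/-- The space of holomorphic functions on `logCover V`; a function on `logCover V` is represented by
its extension by zero to `ℂ`. -/
def Hol (V : Opens ℂ) : Submodule ℂ (ℂ → ℂ) where
  carrier := {f | DifferentiableOn ℂ f (logCover V) ∧ ∀ u, u ∉ logCover V → f u = 0}
  zero_mem' := ⟨differentiableOn_const 0, fun _ _ => rfl⟩
  add_mem' := fun hf hg => ⟨hf.1.add hg.1, fun u hu => by
    rw [Pi.add_apply, hf.2 u hu, hg.2 u hu, add_zero]⟩
  smul_mem' := fun c f hf => ⟨hf.1.const_smul c, fun u hu => by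
    rw [Pi.smul_apply, hf.2 u hu, smul_zero]⟩

theorem Hol.differentiableAt {V : Opens ℂ} (f : Hol V) {u : ℂ} (hu : u ∈ logCover V) :
    DifferentiableAt ℂ f.1 u :=
  f.2.1.differentiableAt ((logCover V).2.mem_nhds hu)

open Classical in
/-- `D = z d/dz = d/du`. -/
def holD (V : Opens ℂ) : Module.End ℂ (Hol V) where
  toFun f := ⟨fun u => if u ∈ logCover V then deriv f.1 u else 0,
    (f.2.1.deriv (logCover V).2).congr fun _ hu => if_pos hu, fun _ hu => if_neg hu⟩
  map_add' f g := by
    ext1; funext u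
    by_cases hu : u ∈ logCover V
    · simp [hu, deriv_add (Hol.differentiableAt f hu) (Hol.differentiableAt g hu)]
    · simp [hu]
  map_smul' c f := by
    ext1; funext u
    by_cases hu : u ∈ logCover V
    · simp [hu, deriv_const_smul c (Hol.differentiableAt f hu)]
    · simp [hu]

/-- Multiplication by `z = exp u`. -/
def holZ (V : Opens ℂ) : Module.End ℂ (Hol V) where
  toFun f := ⟨fun u => Complex.exp u * f.1 u,
    Complex.differentiable_exp.differentiableOn.mul f.2.1,
    fun u hu => by beta_reduce; rw [f.2.2 u hu, mul_zero]⟩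
  map_add' f g := by ext1; funext u; simp [mul_add]
  map_smul' c f := by ext1; funext u; simp [mul_left_comm]

/-- `k`-fold analytic continuation around `0` in the positive direction, `u ↦ u + 2πik`. -/
def holDeck (V : Opens ℂ) (k : ℤ) : Module.End ℂ (Hol V) where
  toFun f := ⟨fun u => f.1 (u + twoPiI * k),
    f.2.1.comp (differentiableOn_id.add_const _) fun u hu => (logCover_add V k u).2 hu,
    fun u hu => f.2.2 _ fun h => hu ((logCover_add V k u).1 h)⟩
  map_add' _ _ := rfl
  map_smul' _ _ := rfl

theorem holDeck_commute_D (V : Opens ℂ) (k : ℤ) : Commute (holDeck V k) (holD V) := by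
  refine LinearMap.ext fun f => Subtype.ext (funext fun u => ?_)
  by_cases hu : u ∈ logCover V
  · simp [holDeck, holD, hu, logCover_add, deriv_comp_add_const]
  · simp [holDeck, holD, hu, logCover_add]

theorem holDeck_commute_Z (V : Opens ℂ) (k : ℤ) : Commute (holDeck V k) (holZ V) := by
  refine LinearMap.ext fun f => Subtype.ext (funext fun u => ?_)
  have h : Complex.exp (u + twoPiI * k) = Complex.exp u := by
    rw [Complex.exp_eq_exp_iff_exists_int]
    exact ⟨k, by simp only [twoPiI]; ring⟩
  simp [holDeck, holZ, h]

/-- The holomorphic solutions on `logCover V`. -/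
def holSolutions (V : Opens ℂ) {n : ℕ} (α β : Fin n → ℂ) : Submodule ℂ (Hol V) :=
  LinearMap.ker (hypOp (holD V) (holZ V) α β)

/-- Analytic continuation of solutions along `k` positive turns around `0`. -/
def holMonodromy (V : Opens ℂ) (k : ℤ) {n : ℕ} (α β : Fin n → ℂ) :
    Module.End ℂ (holSolutions V α β) :=
  (holDeck V k).restrict (mem_ker_of_commute
    (hypOp_commute (holDeck_commute_D V k) (holDeck_commute_Z V k) α β))

/-- The punctured disc `0 < |z| < ρ`. -/
def discZero (ρ : ℝ) : Opens ℂ :=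
  ⟨{z | 0 < ‖z‖ ∧ ‖z‖ < ρ},
    (isOpen_lt continuous_const continuous_norm).inter (isOpen_lt continuous_norm continuous_const)⟩

/-- The punctured disc `R < |z| < ∞` around `∞`. -/
def discInfty (R : ℝ) : Opens ℂ :=
  ⟨{z | R < ‖z‖}, isOpen_lt continuous_const continuous_norm⟩

/-- The value at `z = exp u` of the `l`-th term
`(∂ / (2πi ∂t))^r |_{t = ν} (𝚪(σl + t) z^{σl + t})`, where `z^s = exp (s u)`. -/
def seriesTerm (σ : ℤ) {n : ℕ} (α β : Fin n → ℂ) (ν : ℂ) (r : ℕ) (u : ℂ) (l : ℕ) : ℂ :=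
  (twoPiI⁻¹) ^ r * iteratedDeriv r
    (fun t : ℂ => gammaProd α β ((σ : ℂ) * l + t) * Complex.exp (((σ : ℂ) * l + t) * u)) ν

theorem gammaProd_differentiable {n : ℕ} (α β : Fin n → ℂ) : Differentiable ℂ (gammaProd α β) := by
  have h : gammaProd α β = fun s => (∏ i, (Complex.Gamma (s - α i + 1))⁻¹) *
      ∏ i, (Complex.Gamma (-s + β i + 1))⁻¹ := by
    funext s
    simp [gammaProd, mul_comm]
  rw [h]
  refine Differentiable.mul ?_ ?_
  · refine Differentiable.fun_finsetProd fun i _ => ?_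
    exact Complex.differentiable_one_div_Gamma.comp (by fun_prop : Differentiable ℂ fun s => s - α i + 1)
  · refine Differentiable.fun_finsetProd fun i _ => ?_
    exact Complex.differentiable_one_div_Gamma.comp (by fun_prop : Differentiable ℂ fun s => -s + β i + 1)

/-- The coefficients of the formal series are those obtained by differentiating in `t`. -/
theorem seriesTerm_eq (σ : ℤ) {n : ℕ} (α β : Fin n → ℂ) (ν : ℂ) (r : ℕ) (u : ℂ) (l : ℕ) :
    seriesTerm σ α β ν r u l =
      Complex.exp ((ν + (σ : ℂ) * l) * u) * (logCoeff α β r (ν + (σ : ℂ) * l)).eval u := by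
  have h1 := congrFun (iteratedDeriv_comp_const_add r
    (fun s : ℂ => gammaProd α β s * Complex.exp (s * u)) ((σ : ℂ) * l)) ν
  have h2 : ∀ s : ℂ, ∀ p, iteratedDeriv p (fun s : ℂ => Complex.exp (s * u)) s
      = u ^ p * Complex.exp (s * u) := by
    intro s p
    simp [mul_comm _ u]
  have h3 := iteratedDeriv_fun_mul (n := r) (x := (σ : ℂ) * l + ν) (f := gammaProd α β)
    (g := fun s : ℂ => Complex.exp (s * u)) (gammaProd_differentiable α β).contDiff.contDiffAt
    (by fun_prop)
  simp only [seriesTerm, h1, h3, h2, logCoeff, eval_finsetSum, Finset.mul_sum]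
  rw [← Finset.sum_range_reflect]
  refine Finset.sum_congr rfl fun p hp => ?_
  have hp' : p ≤ r := Nat.lt_succ_iff.1 (Finset.mem_range.1 hp)
  have e : r + 1 - 1 - p = r - p := by omega
  have e' : r - (r - p) = p := by omega
  simp only [e, e', Nat.choose_symm hp', eval_mul, eval_C, eval_pow, eval_X,
    add_comm ((σ : ℂ) * l) ν]
  ring

end Hypergeom

end

/-!
The functional equation of `𝚪` says that `s ↦ 𝚪(s) z ^ s`, summed over a progression infinite in
both directions, is annihilated by the operator, and so are the derivatives of this sum in `t`. At
`ν(A) - 1`, `ν(A) - 2`, … the function `𝚪` vanishes to order at least `m_A`, so for `r < m_A` the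
one-sided sum `S_{A,r}` agrees with the two-sided one and is a solution; the same happens at `∞`.

By Leibniz' rule the monodromy acts on the `S_{A,r}` through `Dᵗ`, each of whose eigenvectors is
concentrated in a single position `(A, 0)`. A nontrivial space of relations among the `S_{A,r}`,
being invariant, would contain such an eigenvector, so the `S_{A,r}` are independent once the
`S_{A,0}` are nonzero.

There are `n` of them, and the dimension is at most `n`. For formal solutions, `α_i - β_j ∉ ℤ` lets
the recurrence run in both directions from a single exponent beyond the zeros of the indicial
polynomial, where the coefficient is a polynomial in `log z` of degree less than `m_A`. For
holomorphic ones, the equation has order `n` and no singular point other than `0`, `(-1)ⁿ`, `∞`.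

For convergence, the functional equation bounds the growth of `𝚪` along `l + t`, uniformly on a
circle of parameters `t`, and Cauchy's estimate passes from `𝚪(l + t) z ^ (l + t)` to its
derivatives in `t`.
-/

noncomputable section

namespace Hypergeom

/-! ### The functional equation of the gamma product -/

section GammaProd

variable {n : ℕ} (α β : Fin n → ℂ) (s : ℂ)

theorem gammaProd_eq_prod_inv :
    gammaProd α β s = (∏ i, (Complex.Gamma (s - α i + 1))⁻¹) *
      ∏ i, (Complex.Gamma (-s + β i + 1))⁻¹ := by
  simp [gammaProd, mul_comm]

theorem gammaProd_neg : gammaProd (-β) (-α) (-s) = gammaProd α β s := by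
  simp [gammaProd, mul_comm, ← sub_eq_add_neg, sub_eq_neg_add]

theorem prod_sub_mul_gammaProd :
    (-1) ^ n * (∏ i, (s - α i)) * gammaProd α β s =
      (∏ j, (s - 1 - β j)) * gammaProd α β (s - 1) := by
  have hα : ∀ i, (Complex.Gamma (s - 1 - α i + 1))⁻¹ =
      (s - α i) * (Complex.Gamma (s - α i + 1))⁻¹ := fun i => by
    rw [← Complex.one_div_Gamma_eq_self_mul_one_div_Gamma_add_one]
    congr 2; ring
  have hβ : ∀ j, (Complex.Gamma (-s + β j + 1))⁻¹ =
      (-s + β j + 1) * (Complex.Gamma (-(s - 1) + β j + 1))⁻¹ := fun j => by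
    rw [Complex.one_div_Gamma_eq_self_mul_one_div_Gamma_add_one]
    congr 3; ring
  have hsign : ∏ j, (s - 1 - β j) = (-1) ^ n * ∏ j, (-s + β j + 1) := by
    rw [← Fin.prod_const, ← Finset.prod_mul_distrib]
    exact Finset.prod_congr rfl fun j _ => by ring
  rw [gammaProd_eq_prod_inv, gammaProd_eq_prod_inv, hsign]
  simp_rw [hα, hβ, Finset.prod_mul_distrib]
  ring

end GammaProd

theorem twoPiI_ne_zero : twoPiI ≠ 0 := Complex.two_pi_I_ne_zero

theorem exp_twoPiI_mul_eq_iff {x y : ℂ} :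
    Complex.exp (twoPiI * x) = Complex.exp (twoPiI * y) ↔ ∃ k : ℤ, x = y + k := by
  rw [Complex.exp_eq_exp_iff_exists_int]
  refine exists_congr fun k => ?_
  rw [← mul_right_inj' twoPiI_ne_zero (b := x), mul_add, mul_comm twoPiI (k : ℂ)]
  rfl

theorem exp_twoPiI_mul_add_int (a : ℂ) (k : ℤ) :
    Complex.exp (twoPiI * (a + k)) = Complex.exp (twoPiI * a) :=
  exp_twoPiI_mul_eq_iff.2 ⟨k, rfl⟩

/-! ### The formal equation, coefficient by coefficient -/

/-- The operator `a + d/dX`, through which `D` acts on the coefficient of `z^a`. -/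
def shiftedDeriv (a : ℂ) : Module.End ℂ ℂ[X] := algebraMap ℂ (Module.End ℂ ℂ[X]) a + derivative

theorem shiftedDeriv_apply (a : ℂ) (p : ℂ[X]) : shiftedDeriv a p = a • p + derivative p := rfl

theorem map_aeval_apply {R M N : Type*} [CommSemiring R] [AddCommMonoid M] [Module R M]
    [AddCommMonoid N] [Module R N] (φ : M →ₗ[R] N) {D : Module.End R M} {E : Module.End R N}
    (h : ∀ x, φ (D x) = E (φ x)) (p : R[X]) (x : M) : φ (aeval D p x) = aeval E p (φ x) := by
  induction p using Polynomial.induction_on generalizing x with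
  | C c => simp
  | add p q hp hq => simp [hp, hq]
  | monomial k c ih =>
    rw [pow_succ, ← mul_assoc, map_mul (aeval D), map_mul (aeval E), aeval_X, aeval_X,
      Module.End.mul_apply, Module.End.mul_apply, ih, h]

theorem aeval_formalD_apply (σ : ℤ) (p : ℂ[X]) (f : FormalLog σ) (a : ℂ) :
    (aeval (formalD σ) p f).1 a = aeval (shiftedDeriv a) p (f.1 a) :=
  map_aeval_apply (LinearMap.proj a ∘ₗ (FormalLog σ).subtype) (E := shiftedDeriv a)
    (fun _ => rfl) p f

theorem mem_formalSolutions_iff {σ : ℤ} {n : ℕ} {α β : Fin n → ℂ} {f : FormalLog σ} :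
    f ∈ formalSolutions σ α β ↔ ∀ a,
      (-1 : ℂ) ^ n • aeval (shiftedDeriv a) (∏ i, (X - C (α i))) (f.1 a) =
        aeval (shiftedDeriv (a - 1)) (∏ j, (X - C (β j))) (f.1 (a - 1)) := by
  rw [formalSolutions, LinearMap.mem_ker, ← Subtype.coe_inj, funext_iff]
  refine forall_congr' fun a => ?_
  rw [← aeval_formalD_apply, ← aeval_formalD_apply]
  exact sub_eq_zero

/-! ### Leibniz polynomials -/

/-- The polynomial `L` with `(∂ / (2πi ∂s))^r (g(s) z^s) = z^s L(log z)`, see `leibnizPoly_eval`;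
`logCoeff` is the case `g = 𝚪`. -/
def leibnizPoly (g : ℂ → ℂ) (r : ℕ) (s : ℂ) : ℂ[X] :=
  ∑ p ∈ Finset.range (r + 1),
    C ((twoPiI⁻¹) ^ r * (r.choose p : ℂ) * iteratedDeriv (r - p) g s) * X ^ p

theorem logCoeff_eq_leibnizPoly {n : ℕ} (α β : Fin n → ℂ) (r : ℕ) (s : ℂ) :
    logCoeff α β r s = leibnizPoly (gammaProd α β) r s := rfl

theorem leibnizPoly_coeff (g : ℂ → ℂ) (r : ℕ) (s : ℂ) (p : ℕ) :
    (leibnizPoly g r s).coeff p =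
      (twoPiI⁻¹) ^ r * (r.choose p : ℂ) * iteratedDeriv (r - p) g s := by
  simp only [leibnizPoly, finsetSum_coeff, coeff_C_mul, coeff_X_pow, mul_ite, mul_one, mul_zero]
  rw [Finset.sum_ite_eq]
  split_ifs with h
  · rfl
  · rw [Nat.choose_eq_zero_of_lt (by simpa using h), Nat.cast_zero, mul_zero, zero_mul]

theorem iteratedDeriv_mul_cexp {f : ℂ → ℂ} (hf : Differentiable ℂ f) (r : ℕ) (a c : ℂ) :
    iteratedDeriv r (fun s => f s * Complex.exp (s * c)) a =
      Complex.exp (a * c) *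
        ∑ p ∈ Finset.range (r + 1), (r.choose p : ℂ) * c ^ p * iteratedDeriv (r - p) f a := by
  have hexp : ∀ p, iteratedDeriv p (fun s : ℂ => Complex.exp (s * c)) a =
      c ^ p * Complex.exp (a * c) := fun p => by simp [mul_comm _ c]
  simp_rw [mul_comm (f _)]
  rw [iteratedDeriv_fun_mul (by fun_prop) hf.contDiff.contDiffAt, Finset.mul_sum]
  refine Finset.sum_congr rfl fun p _ => ?_
  rw [hexp]
  ring

theorem leibnizPoly_eval {g : ℂ → ℂ} (hg : Differentiable ℂ g) (r : ℕ) (s u : ℂ) :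
    Complex.exp (s * u) * (leibnizPoly g r s).eval u =
      (twoPiI⁻¹) ^ r * iteratedDeriv r (fun t => g t * Complex.exp (t * u)) s := by
  rw [iteratedDeriv_mul_cexp hg, mul_left_comm, mul_right_inj' (Complex.exp_ne_zero _),
    leibnizPoly, eval_finsetSum, Finset.mul_sum]
  refine Finset.sum_congr rfl fun p _ => ?_
  simp only [eval_mul, eval_C, eval_pow, eval_X]
  ring

theorem iteratedDeriv_id_mul {g : ℂ → ℂ} (hg : Differentiable ℂ g) (k : ℕ) (t : ℂ) :
    iteratedDeriv k (fun t => t * g t) t =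
      t * iteratedDeriv k g t + k * iteratedDeriv (k - 1) g t := by
  rw [iteratedDeriv_fun_mul contDiffAt_fun_id hg.contDiff.contDiffAt]
  rcases k with _ | k
  · simp
  · rw [Finset.sum_range_succ', Finset.sum_range_succ']
    simp [iteratedDeriv_fun_id, add_comm]

theorem shiftedDeriv_leibnizPoly {g : ℂ → ℂ} (hg : Differentiable ℂ g) (r : ℕ) (a : ℂ) :
    shiftedDeriv a (leibnizPoly g r a) = leibnizPoly (fun t => t * g t) r a := by
  ext p
  rw [shiftedDeriv_apply, coeff_add, coeff_smul, coeff_derivative, leibnizPoly_coeff,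
    leibnizPoly_coeff, leibnizPoly_coeff, iteratedDeriv_id_mul hg, smul_eq_mul]
  rcases lt_or_ge r p with h | _
  · rw [Nat.choose_eq_zero_of_lt h, Nat.choose_eq_zero_of_lt (h.trans (Nat.lt_succ_self p))]
    simp
  · have hchoose : ((r.choose (p + 1) : ℕ) : ℂ) * (p + 1) = r.choose p * ((r - p : ℕ) : ℂ) := by
      exact_mod_cast Nat.choose_succ_right_eq r p
    rw [Nat.sub_add_eq]
    linear_combination (twoPiI⁻¹) ^ r * iteratedDeriv (r - p - 1) g a * hchoose

theorem leibnizPoly_const_mul (c : ℂ) (g : ℂ → ℂ) (r : ℕ) (a : ℂ) :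
    leibnizPoly (fun t => c * g t) r a = c • leibnizPoly g r a := by
  ext p
  rw [coeff_smul, leibnizPoly_coeff, leibnizPoly_coeff, iteratedDeriv_const_mul_field, smul_eq_mul]
  ring

theorem leibnizPoly_add {g h : ℂ → ℂ} (hg : Differentiable ℂ g) (hh : Differentiable ℂ h)
    (r : ℕ) (a : ℂ) :
    leibnizPoly (fun t => g t + h t) r a = leibnizPoly g r a + leibnizPoly h r a := by
  ext p
  rw [coeff_add, leibnizPoly_coeff, leibnizPoly_coeff, leibnizPoly_coeff,
    iteratedDeriv_fun_add hg.contDiff.contDiffAt hh.contDiff.contDiffAt]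
  ring

theorem leibnizPoly_comp_sub (g : ℂ → ℂ) (r : ℕ) (a c : ℂ) :
    leibnizPoly (fun t => g (t - c)) r a = leibnizPoly g r (a - c) := by
  simp only [leibnizPoly, iteratedDeriv_comp_sub_const]

theorem aeval_shiftedDeriv_leibnizPoly {g : ℂ → ℂ} (hg : Differentiable ℂ g) (r : ℕ) (a : ℂ)
    (p : ℂ[X]) :
    aeval (shiftedDeriv a) p (leibnizPoly g r a) = leibnizPoly (fun t => p.eval t * g t) r a := by
  induction p using Polynomial.induction_on generalizing g with
  | C c => simp [leibnizPoly_const_mul]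
  | add p q hp hq =>
    rw [map_add, LinearMap.add_apply, hp hg, hq hg,
      ← leibnizPoly_add (p.differentiable.fun_mul hg) (q.differentiable.fun_mul hg)]
    simp only [eval_add, add_mul]
  | monomial k c ih =>
    rw [pow_succ, ← mul_assoc, map_mul, aeval_X, Module.End.mul_apply,
      shiftedDeriv_leibnizPoly hg, ih (differentiable_fun_id.fun_mul hg)]
    simp only [eval_mul, eval_C, eval_pow, eval_X, mul_assoc]

theorem aeval_shiftedDeriv_logCoeff {n : ℕ} (α β : Fin n → ℂ) (r : ℕ) (a : ℂ) :
    (-1 : ℂ) ^ n • aeval (shiftedDeriv a) (∏ i, (X - C (α i))) (logCoeff α β r a) =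
      aeval (shiftedDeriv (a - 1)) (∏ j, (X - C (β j))) (logCoeff α β r (a - 1)) := by
  have hG := gammaProd_differentiable α β
  rw [logCoeff_eq_leibnizPoly, logCoeff_eq_leibnizPoly, aeval_shiftedDeriv_leibnizPoly hG,
    aeval_shiftedDeriv_leibnizPoly hG, ← leibnizPoly_const_mul, ← leibnizPoly_comp_sub]
  congr 1
  funext t
  simp only [eval_prod, eval_sub, eval_X, eval_C]
  rw [← prod_sub_mul_gammaProd, mul_assoc]

theorem leibnizPoly_comp_X_add_C {g : ℂ → ℂ} (hg : Differentiable ℂ g) (r : ℕ) (a : ℂ) :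
    (leibnizPoly g r a).comp (X + C twoPiI) =
      ∑ q ∈ Finset.range (r + 1), (r.choose q : ℂ) • leibnizPoly g q a := by
  refine Polynomial.funext fun u => ?_
  have hsplit : (fun t => g t * Complex.exp (t * (u + twoPiI))) =
      fun t => g t * Complex.exp (t * u) * Complex.exp (t * twoPiI) := by
    funext t
    rw [mul_add, Complex.exp_add, mul_assoc]
  have hf : Differentiable ℂ fun t => g t * Complex.exp (t * u) := by fun_prop
  rw [← mul_right_inj' (Complex.exp_ne_zero (a * (u + twoPiI))), eval_comp]
  simp only [eval_add, eval_X, eval_C]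
  rw [leibnizPoly_eval hg, hsplit, iteratedDeriv_mul_cexp hf, ← Finset.sum_flip,
    eval_finsetSum, Finset.mul_sum, Finset.mul_sum, Finset.mul_sum]
  refine Finset.sum_congr rfl fun q hq => ?_
  have hqr : q ≤ r := Nat.lt_succ_iff.1 (Finset.mem_range.1 hq)
  have hpow : (twoPiI⁻¹) ^ r * twoPiI ^ (r - q) = (twoPiI⁻¹) ^ q := by
    rw [inv_pow, inv_pow, ← pow_sub_mul_pow twoPiI hqr]
    field_simp [twoPiI_ne_zero]
  rw [Nat.choose_symm hqr, Nat.sub_sub_self hqr, eval_smul, smul_eq_mul, mul_add, Complex.exp_add]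
  linear_combination (-(r.choose q : ℂ) * Complex.exp (a * twoPiI)) * leibnizPoly_eval hg q a u +
    (r.choose q : ℂ) * Complex.exp (a * twoPiI) *
      iteratedDeriv q (fun t => g t * Complex.exp (t * u)) a * hpow

/-! ### Bases adapted to a monodromy operator -/

theorem eq_bot_of_forall_hasEigenvector_notMem {K V : Type*} [Field K] [IsAlgClosed K]
    [AddCommGroup V] [Module K V] [FiniteDimensional K V] {M : Module.End K V} {p : Submodule K V}
    (hM : ∀ v ∈ p, M v ∈ p) (hp : ∀ c v, M.HasEigenvector c v → v ∉ p) : p = ⊥ := by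
  by_contra hne
  have : Nontrivial p := Submodule.nontrivial_iff_ne_bot.2 hne
  obtain ⟨c, hc⟩ := Module.End.exists_eigenvalue (M.restrict hM)
  obtain ⟨⟨v, hvp⟩, hv⟩ := hc.exists_hasEigenvector
  refine hp c v ⟨?_, fun h => hv.2 (Subtype.ext h)⟩ hvp
  exact Module.End.mem_eigenspace_iff.2 (congrArg Subtype.val hv.apply_eq_smul)

theorem natDegree_eq_zero_of_taylor_eq {R : Type*} [CommRing R] [IsDomain R] [CharZero R]
    {P : R[X]} (h : taylor 1 P = P) : P.natDegree = 0 := by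
  have heval : ∀ k : ℕ, P.eval (k : R) = P.eval 0 := fun k => by
    induction k with
    | zero => simp
    | succ k ih => rw [← ih, Nat.cast_succ, ← taylor_eval, h]
  have hP : P = C (P.eval 0) := by
    refine eq_of_infinite_eval_eq _ _ ((Set.infinite_range_of_injective
      (Nat.cast_injective (R := R))).mono ?_)
    rintro _ ⟨k, rfl⟩
    simp [heval]
  rw [hP, natDegree_C]

theorem eq_one_of_taylor_eq_smul {R : Type*} [CommRing R] [IsDomain R] {P : R[X]} {c r : R}
    (h : taylor r P = c • P) (hP : P ≠ 0) : c = 1 := by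
  have hlead : c * P.leadingCoeff = P.leadingCoeff := by
    rw [← leadingCoeff_C c, ← leadingCoeff_mul, ← smul_eq_C_mul, ← h, leadingCoeff_taylor]
  exact (mul_eq_right₀ (leadingCoeff_ne_zero.2 hP)).1 hlead

theorem expValues_ne_zero {n : ℕ} (x : Fin n → ℂ) (A : expValues x) : (A : ℂ) ≠ 0 := by
  obtain ⟨k, -, hk⟩ := Finset.mem_image.1 A.2
  rw [← hk]
  exact Complex.exp_ne_zero _

theorem blockD_same {n : ℕ} (x : Fin n → ℂ) (A : expValues x) (r q : Fin (mult x A)) :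
    blockD x ⟨A, r⟩ ⟨A, q⟩ = ((r : ℕ).choose (q : ℕ) : ℂ) * A := by
  unfold blockD
  split_ifs with h
  · rfl
  · rw [Nat.choose_eq_zero_of_lt (by simpa using h), Nat.cast_zero, zero_mul]

/-- The coordinates of `v` in the block of `A`, as the coefficients of a polynomial: the transpose
of `blockD x` then acts on this block by `P ↦ A • P(X + 1)`. -/
def blockPoly {n : ℕ} {x : Fin n → ℂ} (v : LocalIndex x → ℂ) (A : expValues x) : ℂ[X] :=
  ∑ r : Fin (mult x A), C (v ⟨A, r⟩) * X ^ (r : ℕ)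

section BlockPoly

variable {n : ℕ} {x : Fin n → ℂ} (v : LocalIndex x → ℂ) (A : expValues x)

theorem blockPoly_coeff (r : Fin (mult x A)) : (blockPoly v A).coeff r = v ⟨A, r⟩ := by
  simp [blockPoly, coeff_X_pow, Fin.val_inj]

theorem blockPoly_coeff_of_le {k : ℕ} (hk : mult x A ≤ k) : (blockPoly v A).coeff k = 0 := by
  simp only [blockPoly, finsetSum_coeff, coeff_C_mul_X_pow]
  exact Finset.sum_eq_zero fun r _ => if_neg fun h => by omega

theorem taylor_blockPoly_coeff (k : ℕ) :
    (taylor 1 (blockPoly v A)).coeff k =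
      ∑ q : Fin (mult x A), v ⟨A, q⟩ * ((q : ℕ).choose k : ℂ) := by
  simp only [blockPoly, map_sum, taylor_mul, taylor_C, taylor_X_pow, finsetSum_coeff, coeff_C_mul,
    C_1, coeff_X_add_one_pow]

theorem transpose_blockD_mulVec (r : Fin (mult x A)) :
    (blockD x).transpose.mulVec v ⟨A, r⟩ =
      A * ∑ q : Fin (mult x A), v ⟨A, q⟩ * ((q : ℕ).choose (r : ℕ) : ℂ) := by
  rw [Matrix.mulVec, dotProduct, Fintype.sum_sigma, Finset.sum_eq_single A, Finset.mul_sum]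
  · refine Finset.sum_congr rfl fun q _ => ?_
    rw [Matrix.transpose_apply, blockD_same]
    ring
  · refine fun B _ hB => Finset.sum_eq_zero fun q _ => ?_
    rw [Matrix.transpose_apply, blockD, if_neg fun h => hB h.1, zero_mul]
  · simp

theorem blockPoly_transpose_blockD_mulVec :
    blockPoly ((blockD x).transpose.mulVec v) A = (A : ℂ) • taylor 1 (blockPoly v A) := by
  ext k
  rw [coeff_smul, taylor_blockPoly_coeff, smul_eq_mul]
  rcases lt_or_ge k (mult x A) with hk | hk
  · rw [blockPoly_coeff _ _ ⟨k, hk⟩, transpose_blockD_mulVec]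
  · rw [blockPoly_coeff_of_le _ _ hk, Finset.sum_eq_zero, mul_zero]
    intro q _
    rw [Nat.choose_eq_zero_of_lt (q.2.trans_le hk), Nat.cast_zero, mul_zero]

variable {v A}

theorem eq_and_eq_zero_of_hasEigenvector {c : ℂ}
    (hv : Module.End.HasEigenvector (blockD x).transpose.mulVecLin c v) {r : Fin (mult x A)}
    (hr : v ⟨A, r⟩ ≠ 0) : (A : ℂ) = c ∧ (r : ℕ) = 0 := by
  have hAv : (blockD x).transpose.mulVec v = c • v := hv.apply_eq_smul
  have hP : blockPoly v A ≠ 0 := fun h => hr (by rw [← blockPoly_coeff v A r, h, coeff_zero])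
  have hA := expValues_ne_zero x A
  have htaylor : taylor 1 (blockPoly v A) = ((A : ℂ)⁻¹ * c) • blockPoly v A := by
    rw [mul_smul, eq_inv_smul_iff₀ hA, ← blockPoly_transpose_blockD_mulVec, hAv]
    simp only [blockPoly, Pi.smul_apply, smul_eq_mul, map_mul, Finset.smul_sum, smul_eq_C_mul,
      mul_assoc]
  have hc := eq_one_of_taylor_eq_smul htaylor hP
  rw [hc, one_smul] at htaylor
  refine ⟨(inv_mul_eq_one₀ hA).1 hc, ?_⟩
  have hle := le_natDegree_of_ne_zero (by rwa [blockPoly_coeff] : (blockPoly v A).coeff r ≠ 0)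
  rwa [natDegree_eq_zero_of_taylor_eq htaylor, Nat.le_zero] at hle

theorem exists_eq_single_of_hasEigenvector {c : ℂ}
    (hv : Module.End.HasEigenvector (blockD x).transpose.mulVecLin c v) :
    ∃ (A : expValues x) (h : 0 < mult x A) (a : ℂ), a ≠ 0 ∧ v = Pi.single ⟨A, ⟨0, h⟩⟩ a := by
  obtain ⟨⟨A, r⟩, hr⟩ := Function.ne_iff.1 hv.2
  obtain ⟨hAc, hr0⟩ := eq_and_eq_zero_of_hasEigenvector hv hr
  have hr_eq : r = ⟨0, r.pos⟩ := Fin.ext hr0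
  rw [hr_eq] at hr
  refine ⟨A, r.pos, v ⟨A, ⟨0, r.pos⟩⟩, hr, funext fun ⟨B, s⟩ => ?_⟩
  by_cases hs : v ⟨B, s⟩ = 0
  · rw [Pi.single_apply, hs]
    split_ifs with h
    · rw [← h, hs]
    · rfl
  · obtain ⟨hBc, hs0⟩ := eq_and_eq_zero_of_hasEigenvector hv hs
    obtain rfl : B = A := Subtype.ext (hBc.trans hAc.symm)
    rw [show s = ⟨0, r.pos⟩ from Fin.ext hs0, Pi.single_eq_same]

end BlockPoly

section Basis

variable {n : ℕ} {x : Fin n → ℂ} {V : Type*} [AddCommGroup V] [Module ℂ V] {T : Module.End ℂ V}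
  {S : LocalIndex x → V}

theorem linearIndependent_of_blockD (hT : ∀ q, T (S q) = ∑ p, blockD x q p • S p)
    (h0 : ∀ (A : expValues x) (h : 0 < mult x A), S ⟨A, ⟨0, h⟩⟩ ≠ 0) :
    LinearIndependent ℂ S := by
  have hcomm : ∀ v, Fintype.linearCombination ℂ S ((blockD x).transpose.mulVecLin v) =
      T (Fintype.linearCombination ℂ S v) := fun v => by
    simp only [Fintype.linearCombination_apply, Matrix.mulVecLin_apply, Matrix.mulVec, dotProduct,
      Matrix.transpose_apply, map_sum, map_smul, hT, Finset.sum_smul, Finset.smul_sum, smul_smul,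
      mul_comm]
    exact Finset.sum_comm
  rw [linearIndependent_iff_injective_fintypeLinearCombination, ← LinearMap.ker_eq_bot]
  refine eq_bot_of_forall_hasEigenvector_notMem (M := (blockD x).transpose.mulVecLin)
    (fun v hv => ?_) fun c v hv hker => ?_
  · rw [LinearMap.mem_ker] at hv ⊢
    rw [hcomm, hv, map_zero]
  · obtain ⟨A, h, a, ha, rfl⟩ := exists_eq_single_of_hasEigenvector hv
    rw [LinearMap.mem_ker, Fintype.linearCombination_apply_single] at hker
    exact smul_ne_zero ha (h0 A h) hker

theorem card_localIndex (x : Fin n → ℂ) : Fintype.card (LocalIndex x) = n := by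
  simp only [Fintype.card_sigma, Fintype.card_fin]
  unfold mult
  rw [Finset.sum_coe_sort (expValues x)
    fun A => (Finset.univ.filter fun k => Complex.exp (twoPiI * x k) = A).card, expValues,
    ← Finset.card_eq_sum_card_image, Finset.card_univ, Fintype.card_fin]

theorem exists_basis_of_blockD [Module.Finite ℂ V] (hV : Module.finrank ℂ V ≤ n)
    (hT : ∀ q, T (S q) = ∑ p, blockD x q p • S p)
    (h0 : ∀ (A : expValues x) (h : 0 < mult x A), S ⟨A, ⟨0, h⟩⟩ ≠ 0) :
    ∃ b : Module.Basis (LocalIndex x) ℂ V, (∀ q, b q = S q) ∧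
      LinearMap.toMatrix b b T = (blockD x).transpose := by
  have hli := linearIndependent_of_blockD hT h0
  have hcard : Fintype.card (LocalIndex x) = Module.finrank ℂ V :=
    le_antisymm hli.fintype_card_le_finrank (by rwa [card_localIndex])
  let b := Module.Basis.mk hli (hli.span_eq_top_of_card_eq_finrank' hcard).ge
  have hb : ∀ q, b q = S q := fun q => Module.Basis.mk_apply _ _ q
  refine ⟨b, hb, ?_⟩
  ext p q
  rw [LinearMap.toMatrix_apply, hb, hT, map_sum]
  simp_rw [← hb]
  simp [Finsupp.single_apply]

end Basis

/-! ### Zeros of the gamma product -/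

theorem card_le_analyticOrderAt_prod {𝕜 ι : Type*} [NontriviallyNormedField 𝕜] {h : ι → 𝕜 → 𝕜}
    {a : 𝕜} (s : Finset ι) (hh : ∀ i, AnalyticAt 𝕜 (h i) a) (h0 : ∀ i ∈ s, h i a = 0) :
    (s.card : ℕ∞) ≤ analyticOrderAt (∏ i ∈ s, h i) a := by
  classical
  induction s using Finset.induction_on with
  | empty => simp
  | insert i s hi ih =>
    rw [Finset.prod_insert hi,
      analyticOrderAt_mul (hh i) (Finset.analyticAt_prod _ fun j _ => hh j),
      Finset.card_insert_of_notMem hi, Nat.cast_add, add_comm, Nat.cast_one]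
    refine add_le_add ?_ (ih fun j hj => h0 j (Finset.mem_insert_of_mem hj))
    rw [Order.one_le_iff_ne_zero]
    exact (hh i).analyticOrderAt_ne_zero.2 (h0 i (Finset.mem_insert_self i s))

section Zeros

variable {n : ℕ} {α β : Fin n → ℂ} {a : ℂ} {s : Finset (Fin n)} {k : ℕ}

theorem iteratedDeriv_gammaProd_eq_zero_of_left (hs : ∀ i ∈ s, ∃ m : ℕ, α i = a + 1 + m)
    (hk : k < s.card) : iteratedDeriv k (gammaProd α β) a = 0 := by
  have hΓ := Complex.differentiable_one_div_Gamma
  let f : Fin n → ℂ → ℂ := fun i t => (Complex.Gamma (t - α i + 1))⁻¹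
  let g : ℂ → ℂ := (∏ i ∈ sᶜ, f i) * fun t => ∏ i, (Complex.Gamma (-t + β i + 1))⁻¹
  have hf : ∀ i, AnalyticAt ℂ (f i) a := fun i =>
    (hΓ.comp (by fun_prop : Differentiable ℂ fun t => t - α i + 1)).analyticAt a
  have hg : AnalyticAt ℂ g a := by
    refine (Finset.analyticAt_prod _ fun i _ => hf i).mul (Differentiable.analyticAt ?_ a)
    exact Differentiable.fun_finsetProd fun i _ =>
      hΓ.comp (by fun_prop : Differentiable ℂ fun t => -t + β i + 1)
  have hG : gammaProd α β = (∏ i ∈ s, f i) * g := by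
    rw [← mul_assoc, Finset.prod_mul_prod_compl]
    funext t
    rw [gammaProd_eq_prod_inv, Pi.mul_apply, Finset.prod_apply]
  have hprod : AnalyticAt ℂ (∏ i ∈ s, f i) a := Finset.analyticAt_prod _ fun i _ => hf i
  rw [hG]
  refine (natCast_le_analyticOrderAt_iff_iteratedDeriv_eq_zero (hprod.mul hg)).1 ?_ k hk
  rw [analyticOrderAt_mul hprod hg]
  refine (card_le_analyticOrderAt_prod s hf fun i hi => ?_).trans le_self_add
  obtain ⟨m, hm⟩ := hs i hi
  exact inv_eq_zero.2 ((Complex.Gamma_eq_zero_iff _).2 ⟨m, by rw [hm]; ring⟩)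

theorem gammaProd_eq_comp_neg : gammaProd α β = fun t => gammaProd (-β) (-α) (-t) :=
  funext fun t => (gammaProd_neg α β t).symm

theorem iteratedDeriv_gammaProd_eq_zero_of_right (hs : ∀ i ∈ s, ∃ m : ℕ, a = β i + 1 + m)
    (hk : k < s.card) : iteratedDeriv k (gammaProd α β) a = 0 := by
  rw [gammaProd_eq_comp_neg, iteratedDeriv_comp_neg,
    iteratedDeriv_gammaProd_eq_zero_of_left (fun i hi => ?_) hk, smul_zero]
  obtain ⟨m, rfl⟩ := hs i hi
  exact ⟨m, by rw [Pi.neg_apply]; ring⟩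

theorem exists_gammaProd_add_nat_ne_zero (ha : ∀ (j : Fin n) (k : ℤ), a ≠ β j + k) :
    ∃ l : ℕ, gammaProd α β (a + l) ≠ 0 := by
  obtain ⟨M, hM⟩ := (Set.finite_range fun i => (α i - a).re).bddAbove
  obtain ⟨l, hl⟩ := exists_nat_gt M
  refine ⟨l, ?_⟩
  rw [gammaProd_eq_prod_inv]
  refine mul_ne_zero ?_ ?_ <;> refine Finset.prod_ne_zero_iff.2 fun i _ => inv_ne_zero ?_
  · refine Complex.Gamma_ne_zero_of_re_pos ?_
    have hi : (α i - a).re < l := (hM ⟨i, rfl⟩).trans_lt hl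
    simp only [Complex.sub_re, Complex.add_re, Complex.natCast_re, Complex.one_re] at hi ⊢
    linarith
  · refine Complex.Gamma_ne_zero fun m hm => ha i (m + 1 - l) ?_
    push_cast
    linear_combination -hm

theorem exists_gammaProd_sub_nat_ne_zero (ha : ∀ (j : Fin n) (k : ℤ), α j ≠ a + k) :
    ∃ l : ℕ, gammaProd α β (a - l) ≠ 0 := by
  obtain ⟨l, hl⟩ := exists_gammaProd_add_nat_ne_zero (α := -β) (β := -α) (a := -a) fun j k h =>
    ha j k (by rw [Pi.neg_apply] at h; linear_combination h)
  refine ⟨l, ?_⟩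
  rwa [← gammaProd_neg, neg_sub, sub_eq_neg_add, add_comm, ← sub_eq_add_neg, sub_eq_neg_add]

end Zeros

/-! ### Local exponents -/

section Exponents

variable {n : ℕ} {x : Fin n → ℂ} {A : expValues x} {i : Fin n}

theorem exp_nuMin (x : Fin n → ℂ) (A : expValues x) :
    Complex.exp (twoPiI * nuMin x A) = A := (exists_min_re x A).choose_spec.1

theorem exp_nuMax (x : Fin n → ℂ) (A : expValues x) :
    Complex.exp (twoPiI * nuMax x A) = A := (exists_max_re x A).choose_spec.1

theorem exists_eq_add_nat_of_exp_eq {a b : ℂ}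
    (h : Complex.exp (twoPiI * a) = Complex.exp (twoPiI * b)) (hre : b.re ≤ a.re) :
    ∃ m : ℕ, a = b + m := by
  obtain ⟨k, rfl⟩ := exp_twoPiI_mul_eq_iff.1 h
  lift k to ℕ using by simpa using hre
  exact ⟨k, by simp⟩

theorem exists_eq_nuMin_add_nat (hi : Complex.exp (twoPiI * x i) = A) :
    ∃ m : ℕ, x i = nuMin x A + m :=
  exists_eq_add_nat_of_exp_eq (hi.trans (exp_nuMin x A).symm)
    ((exists_min_re x A).choose_spec.2 i hi)

theorem exists_nuMax_eq_add_nat (hi : Complex.exp (twoPiI * x i) = A) :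
    ∃ m : ℕ, nuMax x A = x i + m :=
  exists_eq_add_nat_of_exp_eq ((exp_nuMax x A).trans hi.symm)
    ((exists_max_re x A).choose_spec.2 i hi)

end Exponents

/-- The properties of the exponents `ν(A)` (at `0`: `σ = 1`, `x = α`) and `ν'(B)` (at `∞`: `σ = -1`,
`x = β`) from which the description of the local solutions follows. -/
structure IsLocalExponent (σ : ℤ) {n : ℕ} (α β x : Fin n → ℂ) (ν : expValues x → ℂ) : Prop where
  exp_eq : ∀ A, Complex.exp (twoPiI * ν A) = A
  iteratedDeriv_eq_zero : ∀ A k, k < mult x A → ∀ j : ℕ,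
    iteratedDeriv k (gammaProd α β) (ν A - σ * (j + 1)) = 0
  exists_ne_zero : ∀ A, ∃ l : ℕ, gammaProd α β (ν A + σ * l) ≠ 0

section IsLocalExponent

variable {n : ℕ} {α β : Fin n → ℂ}

theorem isLocalExponent_nuMin (hαβ : ∀ (i j : Fin n) (k : ℤ), α i ≠ β j + (k : ℂ)) :
    IsLocalExponent 1 α β α (nuMin α) where
  exp_eq := exp_nuMin α
  iteratedDeriv_eq_zero A k hk j := by
    refine iteratedDeriv_gammaProd_eq_zero_of_left (fun i hi => ?_) hk
    obtain ⟨m, hm⟩ := exists_eq_nuMin_add_nat (Finset.mem_filter.1 hi).2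
    exact ⟨m + j, by rw [hm]; push_cast; ring⟩
  exists_ne_zero A := by
    simpa using exists_gammaProd_add_nat_ne_zero (α := α) (a := nuMin α A) (hαβ _)

theorem isLocalExponent_nuMax (hαβ : ∀ (i j : Fin n) (k : ℤ), α i ≠ β j + (k : ℂ)) :
    IsLocalExponent (-1) α β β (nuMax β) where
  exp_eq := exp_nuMax β
  iteratedDeriv_eq_zero A k hk j := by
    refine iteratedDeriv_gammaProd_eq_zero_of_right (fun i hi => ?_) hk
    obtain ⟨m, hm⟩ := exists_nuMax_eq_add_nat (Finset.mem_filter.1 hi).2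
    exact ⟨m + j, by rw [hm]; push_cast; ring⟩
  exists_ne_zero A := by
    simpa [← sub_eq_add_neg] using
      exists_gammaProd_sub_nat_ne_zero (β := β) (a := nuMax β A) fun j => hαβ j _

end IsLocalExponent

/-! ### The formal series as solutions -/

theorem exists_eq_mul_nat_or_exists_eq_neg_mul_succ {σ : ℤ} (hσ : IsUnit σ) (k : ℤ) :
    (∃ l : ℕ, k = σ * l) ∨ ∃ j : ℕ, k = -(σ * (j + 1)) := by
  rcases Int.isUnit_iff.1 hσ with rfl | rfl <;> rcases k with l | j
  · exact .inl ⟨l, by simp⟩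
  · exact .inr ⟨j, by simp [Int.negSucc_eq]⟩
  · rcases l with _ | j
    · exact .inl ⟨0, by simp⟩
    · exact .inr ⟨j, by simp⟩
  · exact .inl ⟨j + 1, by simp [Int.negSucc_eq]⟩

theorem sum_blockD_smul {n : ℕ} {x : Fin n → ℂ} {V : Type*} [AddCommGroup V] [Module ℂ V]
    (F : expValues x → ℕ → V) (A : expValues x) (r : Fin (mult x A)) :
    ∑ p, blockD x ⟨A, r⟩ p • F p.1 p.2 =
      ∑ s ∈ Finset.range (r + 1), ((r : ℕ).choose s : ℂ) • (A : ℂ) • F A s := by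
  rw [Fintype.sum_sigma, Finset.sum_eq_single A]
  · simp_rw [blockD_same, mul_smul]
    rw [Fin.sum_univ_eq_sum_range fun s => ((r : ℕ).choose s : ℂ) • (A : ℂ) • F A s]
    refine (Finset.sum_subset (Finset.range_subset_range.2 r.2) fun s _ hs => ?_).symm
    rw [Nat.choose_eq_zero_of_lt (by simpa using hs), Nat.cast_zero, zero_smul]
  · refine fun B _ hB => Finset.sum_eq_zero fun q _ => ?_
    rw [blockD, if_neg fun h => hB h.1.symm, zero_smul]
  · simp

section FormalSeries

variable {σ : ℤ} {n : ℕ} {α β x : Fin n → ℂ} {ν : expValues x → ℂ} {A : expValues x} {r : ℕ}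

theorem formalSeries_apply_add_mul_nat (α β : Fin n → ℂ) (a : ℂ) (l : ℕ) :
    (formalSeries σ α β a r).1 (a + σ * l) = logCoeff α β r (a + σ * l) := if_pos ⟨l, rfl⟩

theorem formalSeries_apply_of_forall_ne {a b : ℂ} (h : ∀ l : ℕ, b ≠ a + σ * l) :
    (formalSeries σ α β a r).1 b = 0 := if_neg fun ⟨l, hl⟩ => h l hl

theorem IsLocalExponent.logCoeff_eq_zero (hν : IsLocalExponent σ α β x ν) (hr : r < mult x A)
    (j : ℕ) : logCoeff α β r (ν A - σ * (j + 1)) = 0 := by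
  ext p
  rw [logCoeff_eq_leibnizPoly, leibnizPoly_coeff,
    hν.iteratedDeriv_eq_zero A _ ((Nat.sub_le r p).trans_lt hr), mul_zero, coeff_zero]

open Classical in
theorem IsLocalExponent.formalSeries_apply (hν : IsLocalExponent σ α β x ν) (hσ : IsUnit σ)
    (hr : r < mult x A) (a : ℂ) :
    (formalSeries σ α β (ν A) r).1 a =
      if Complex.exp (twoPiI * a) = A then logCoeff α β r a else 0 := by
  split_ifs with ha
  · obtain ⟨k, rfl⟩ := exp_twoPiI_mul_eq_iff.1 (ha.trans (hν.exp_eq A).symm)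
    rcases exists_eq_mul_nat_or_exists_eq_neg_mul_succ hσ k with ⟨l, rfl⟩ | ⟨j, rfl⟩
    · push_cast
      exact formalSeries_apply_add_mul_nat α β _ l
    · push_cast
      rw [← sub_eq_add_neg, hν.logCoeff_eq_zero hr]
      exact (if_congr Iff.rfl (hν.logCoeff_eq_zero hr j) rfl).trans (ite_self 0)
  · refine formalSeries_apply_of_forall_ne ?_
    rintro l rfl
    refine ha ?_
    rw [← hν.exp_eq A]
    exact_mod_cast exp_twoPiI_mul_add_int (ν A) (σ * l)

theorem IsLocalExponent.formalSeries_mem (hν : IsLocalExponent σ α β x ν) (hσ : IsUnit σ)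
    (hr : r < mult x A) : formalSeries σ α β (ν A) r ∈ formalSolutions σ α β := by
  rw [mem_formalSolutions_iff]
  intro a
  have hexp : Complex.exp (twoPiI * (a - 1)) = Complex.exp (twoPiI * a) := by
    simpa [← sub_eq_add_neg] using exp_twoPiI_mul_add_int a (-1)
  rw [hν.formalSeries_apply hσ hr, hν.formalSeries_apply hσ hr, hexp]
  split_ifs
  · exact aeval_shiftedDeriv_logCoeff α β r a
  · simp only [map_zero, smul_zero]

theorem IsLocalExponent.formalDeck_formalSeries (hν : IsLocalExponent σ α β x ν) (hσ : IsUnit σ)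
    (q : LocalIndex x) :
    formalDeck σ 1 (formalSeries σ α β (ν q.1) q.2) =
      ∑ p, blockD x q p • formalSeries σ α β (ν p.1) p.2 := by
  obtain ⟨A, r⟩ := q
  rw [sum_blockD_smul (fun B s => formalSeries σ α β (ν B) s)]
  refine Subtype.ext (funext fun a => ?_)
  rw [Submodule.coe_sum, Finset.sum_apply]
  change Complex.exp (twoPiI * (1 : ℤ) * a) •
    ((formalSeries σ α β (ν A) r).1 a).comp (X + C (twoPiI * (1 : ℤ))) =
    ∑ s ∈ Finset.range (r + 1), ((r : ℕ).choose s : ℂ) • (A : ℂ) • (formalSeries σ α β (ν A) s).1 a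
  have hlt : ∀ s ∈ Finset.range ((r : ℕ) + 1), s < mult x A := fun s hs =>
    (Nat.lt_succ_iff.1 (Finset.mem_range.1 hs)).trans_lt r.2
  rw [hν.formalSeries_apply hσ r.2, Int.cast_one, mul_one,
    Finset.sum_congr rfl fun s hs => by rw [hν.formalSeries_apply hσ (hlt s hs)]]
  split_ifs with ha
  · rw [logCoeff_eq_leibnizPoly, leibnizPoly_comp_X_add_C (gammaProd_differentiable α β), ha,
      Finset.smul_sum]
    exact Finset.sum_congr rfl fun s _ => smul_comm _ _ _
  · simp only [zero_comp, smul_zero, Finset.sum_const_zero]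

theorem IsLocalExponent.formalSeries_zero_ne_zero (hν : IsLocalExponent σ α β x ν)
    (A : expValues x) : formalSeries σ α β (ν A) 0 ≠ 0 := by
  obtain ⟨l, hl⟩ := hν.exists_ne_zero A
  intro h
  have hcoeff : (formalSeries σ α β (ν A) 0).1 (ν A + σ * l) = 0 := by rw [h]; rfl
  rw [formalSeries_apply_add_mul_nat, logCoeff_eq_leibnizPoly] at hcoeff
  apply hl
  simpa [hcoeff] using (leibnizPoly_coeff (gammaProd α β) 0 (ν A + σ * l) 0).symm

end FormalSeries

/-! ### The dimension of the space of formal solutions -/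

theorem mem_degreeLT_of_shiftedDeriv {a : ℂ} {p : ℂ[X]} {m : ℕ} (ha : a ≠ 0)
    (h : shiftedDeriv a p ∈ degreeLT ℂ m) : p ∈ degreeLT ℂ m := by
  rcases eq_or_ne p 0 with rfl | hp
  · exact Submodule.zero_mem _
  have hdeg : (a • p).degree = p.degree :=
    degree_smul_of_smul_regular _ (IsSMulRegular.of_ne_zero ha)
  rwa [mem_degreeLT, shiftedDeriv_apply, degree_add_eq_left_of_degree_lt, hdeg,
    ← mem_degreeLT] at h
  rw [hdeg]
  exact degree_derivative_lt hp

theorem mem_degreeLT_succ_of_shiftedDeriv {a : ℂ} {p : ℂ[X]} {m : ℕ}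
    (h : shiftedDeriv a p ∈ degreeLT ℂ m) : p ∈ degreeLT ℂ (m + 1) := by
  rcases eq_or_ne a 0 with rfl | ha
  · rw [shiftedDeriv_apply, zero_smul, zero_add, mem_degreeLT, degree_lt_iff_coeff_zero] at h
    rw [mem_degreeLT, degree_lt_iff_coeff_zero]
    rintro (_ | k) hk
    · omega
    · have hcoeff := h k (by omega)
      rw [coeff_derivative] at hcoeff
      exact (mul_eq_zero.1 hcoeff).resolve_right (Nat.cast_add_one_ne_zero k)
  · exact degreeLT_mono (Nat.le_succ m) (mem_degreeLT_of_shiftedDeriv ha h)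

theorem aeval_shiftedDeriv_X_sub_C (a b : ℂ) :
    aeval (shiftedDeriv a) (X - C b) = shiftedDeriv (a - b) := by
  rw [map_sub, aeval_X, aeval_C, shiftedDeriv, shiftedDeriv, map_sub]
  abel

open Classical in
theorem mem_degreeLT_of_aeval_prod {ι : Type*} (s : Finset ι) (x : ι → ℂ) {a : ℂ} {p : ℂ[X]} {m : ℕ}
    (h : aeval (shiftedDeriv a) (∏ i ∈ s, (X - C (x i))) p ∈ degreeLT ℂ m) :
    p ∈ degreeLT ℂ (m + (s.filter fun i => x i = a).card) := by
  induction s using Finset.induction_on generalizing p m with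
  | empty => simpa using h
  | insert i s hi ih =>
    rw [Finset.prod_insert hi, map_mul, Module.End.mul_apply, aeval_shiftedDeriv_X_sub_C] at h
    rw [Finset.filter_insert]
    split_ifs with hx
    · rw [Finset.card_insert_of_notMem (by simp [hi]), add_comm _ 1, ← add_assoc]
      exact ih (mem_degreeLT_succ_of_shiftedDeriv h)
    · exact ih (mem_degreeLT_of_shiftedDeriv (sub_ne_zero.2 (Ne.symm hx)) h)

theorem aeval_shiftedDeriv_mem_degreeLT (q : ℂ[X]) {a : ℂ} {p : ℂ[X]} {m : ℕ}
    (h : p ∈ degreeLT ℂ m) : aeval (shiftedDeriv a) q p ∈ degreeLT ℂ m := by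
  refine aeval_apply_smul_mem_of_le_comap h q _ fun p hp => ?_
  rw [Submodule.mem_comap, shiftedDeriv_apply]
  refine Submodule.add_mem _ (Submodule.smul_mem _ a hp) ?_
  rw [mem_degreeLT] at hp ⊢
  exact degree_derivative_le.trans_lt hp

theorem eventually_forall_ne_mul_natCast {ι : Type*} [Finite ι] {σ : ℤ} (hσ : σ ≠ 0) (y : ι → ℂ) :
    ∀ᶠ k : ℕ in Filter.atTop, ∀ i, y i ≠ σ * k := by
  refine Filter.eventually_all.2 fun i => ?_
  have hinj : Function.Injective fun k : ℕ => (σ : ℂ) * k :=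
    (mul_right_injective₀ (Int.cast_ne_zero.2 hσ)).comp Nat.cast_injective
  rw [← Nat.cofinite_eq_atTop]
  filter_upwards [hinj.tendsto_cofinite.eventually (Filter.eventually_cofinite_ne (y i))]
    with k hk using hk.symm

section Recurrence

variable {σ : ℤ} {n : ℕ} {x y : Fin n → ℂ} {c : ℂ}

theorem eventually_formalLog_apply_sub_eq_zero (hσ : σ ≠ 0) (f : FormalLog σ) (a : ℂ) :
    ∀ᶠ k : ℕ in Filter.atTop, f.1 (a - σ * k) = 0 := by
  obtain ⟨T, N, hf⟩ := f.2
  obtain ⟨K, hK⟩ := Filter.eventually_atTop.1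
    (eventually_forall_ne_mul_natCast hσ fun c : T => a - c)
  filter_upwards [Filter.eventually_ge_atTop K] with k hk
  by_contra hne
  obtain ⟨c, hc, l, hl⟩ := (hf _ hne).1
  exact hK (k + l) (le_add_right hk) ⟨c, hc⟩ (by push_cast; linear_combination hl)

open Classical in
theorem sum_card_filter_le_mult (hσ : σ ≠ 0) {a₀ : ℂ} (A : expValues x)
    (hA : Complex.exp (twoPiI * a₀) = A) (l : ℕ) :
    ∑ j ∈ Finset.range l, (Finset.univ.filter fun i => x i = a₀ + σ * (j + 1)).card ≤ mult x A := by
  rw [← Finset.card_biUnion, mult]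
  · refine Finset.card_le_card fun i hi => ?_
    obtain ⟨j, -, hj⟩ := Finset.mem_biUnion.1 hi
    refine Finset.mem_filter.2 ⟨Finset.mem_univ _, ?_⟩
    rw [(Finset.mem_filter.1 hj).2, ← hA]
    exact exp_twoPiI_mul_eq_iff.2 ⟨σ * (j + 1), by push_cast; rfl⟩
  · intro j _ k _ hjk
    refine Finset.disjoint_left.2 fun i hj hk => hjk ?_
    have h := (Finset.mem_filter.1 hj).2.symm.trans (Finset.mem_filter.1 hk).2
    simpa [hσ] using h

/-- The recurrence which the equation imposes on the coefficients of a formal series, solved for the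
coefficient of `z^a` in terms of the preceding one, that of `z^(a - σ)`. -/
def SatisfiesRecurrence (σ : ℤ) (x y : Fin n → ℂ) (c : ℂ) (f : ℂ → ℂ[X]) : Prop :=
  ∀ a, aeval (shiftedDeriv a) (∏ i, (X - C (x i))) (f a) =
    c • aeval (shiftedDeriv (a - σ)) (∏ j, (X - C (y j))) (f (a - σ))

namespace SatisfiesRecurrence

variable {f : ℂ → ℂ[X]} {a₀ : ℂ}

theorem symm (hf : SatisfiesRecurrence σ x y c f) (hc : c ≠ 0) :
    SatisfiesRecurrence (-σ) y x c⁻¹ f := fun a => by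
  rw [Int.cast_neg, sub_neg_eq_add, hf (a + σ), add_sub_cancel_right, inv_smul_smul₀ hc]

open Classical in
theorem apply_mem_degreeLT (hf : SatisfiesRecurrence σ x y c f) (h0 : f a₀ = 0) (l : ℕ) :
    f (a₀ + σ * l) ∈ degreeLT ℂ
      (∑ j ∈ Finset.range l, (Finset.univ.filter fun i => x i = a₀ + σ * (j + 1)).card) := by
  induction l with
  | zero => simp [h0]
  | succ l ih =>
    rw [Finset.sum_range_succ]
    push_cast
    refine mem_degreeLT_of_aeval_prod _ x ?_
    rw [hf, show a₀ + σ * (l + 1) - (σ : ℂ) = a₀ + σ * l by ring]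
    exact Submodule.smul_mem _ c (aeval_shiftedDeriv_mem_degreeLT _ ih)

theorem apply_add_mul_nat_eq_zero (hf : SatisfiesRecurrence σ x y c f) (h0 : f a₀ = 0)
    (hx : ∀ (l : ℕ) i, x i ≠ a₀ + σ * (l + 1)) (l : ℕ) : f (a₀ + σ * l) = 0 := by
  classical
  have hdeg := hf.apply_mem_degreeLT h0 l
  rw [Finset.sum_eq_zero fun j _ => ?_, mem_degreeLT] at hdeg
  · simpa using hdeg
  · rw [Finset.filter_false_of_mem fun i _ => hx j i, Finset.card_empty]

theorem apply_eq_zero_of_exp_eq (hf : SatisfiesRecurrence σ x y c f) (hσ : IsUnit σ) (hc : c ≠ 0)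
    (h0 : f a₀ = 0) (hx : ∀ (l : ℕ) i, x i ≠ a₀ + σ * (l + 1))
    (hy : ∀ j, Complex.exp (twoPiI * y j) ≠ Complex.exp (twoPiI * a₀)) {b : ℂ}
    (hb : Complex.exp (twoPiI * b) = Complex.exp (twoPiI * a₀)) : f b = 0 := by
  obtain ⟨k, rfl⟩ := exp_twoPiI_mul_eq_iff.1 hb
  rcases exists_eq_mul_nat_or_exists_eq_neg_mul_succ hσ k with ⟨l, rfl⟩ | ⟨l, rfl⟩
  · simpa using hf.apply_add_mul_nat_eq_zero h0 hx l
  · simpa using (hf.symm hc).apply_add_mul_nat_eq_zero h0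
      (fun l j hj => hy j (exp_twoPiI_mul_eq_iff.2 ⟨-σ * (l + 1), by rw [hj]; push_cast; rfl⟩))
      (l + 1)

end SatisfiesRecurrence

section FormalLog

variable {f : FormalLog σ}

theorem SatisfiesRecurrence.apply_mem_degreeLT_mult (hf : SatisfiesRecurrence σ x y c f.1)
    (hσ : σ ≠ 0) {a : ℂ} (A : expValues x) (ha : Complex.exp (twoPiI * a) = A) :
    f.1 a ∈ degreeLT ℂ (mult x A) := by
  classical
  obtain ⟨k, hk⟩ := (eventually_formalLog_apply_sub_eq_zero hσ f a).exists
  have hdeg := hf.apply_mem_degreeLT hk k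
  rw [sub_add_cancel] at hdeg
  refine degreeLT_mono (sum_card_filter_le_mult hσ A ?_ k) hdeg
  rw [← ha, exp_twoPiI_mul_eq_iff]
  exact ⟨-(σ * k), by push_cast; ring⟩

theorem SatisfiesRecurrence.apply_eq_zero_of_exp_notMem (hf : SatisfiesRecurrence σ x y c f.1)
    (hσ : σ ≠ 0) {a : ℂ} (ha : Complex.exp (twoPiI * a) ∉ expValues x) : f.1 a = 0 := by
  obtain ⟨k, hk⟩ := (eventually_formalLog_apply_sub_eq_zero hσ f a).exists
  rw [← sub_add_cancel a (σ * k)]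
  refine hf.apply_add_mul_nat_eq_zero hk (fun l i hi => ha ?_) k
  refine Finset.mem_image.2 ⟨i, Finset.mem_univ _, exp_twoPiI_mul_eq_iff.2 ⟨σ * (l + 1 - k), ?_⟩⟩
  rw [hi]
  push_cast
  ring

end FormalLog

theorem exists_exp_eq_and_forall_ne_add_mul_succ (hσ : σ ≠ 0) (A : expValues x) :
    ∃ a : ℂ, Complex.exp (twoPiI * a) = A ∧ ∀ (l : ℕ) i, x i ≠ a + σ * (l + 1) := by
  obtain ⟨K, hK⟩ := Filter.eventually_atTop.1
    (eventually_forall_ne_mul_natCast hσ fun i => x i - nuMin x A)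
  refine ⟨nuMin x A + σ * K, ?_, fun l i hi => ?_⟩
  · rw [← exp_nuMin x A]
    exact_mod_cast exp_twoPiI_mul_add_int (nuMin x A) (σ * K)
  · exact hK (K + l + 1) (by omega) i (by push_cast; linear_combination hi)

theorem finrank_le_of_satisfiesRecurrence (hσ : IsUnit σ) (hc : c ≠ 0)
    (hxy : ∀ i j (k : ℤ), x i ≠ y j + k) (W : Submodule ℂ (FormalLog σ))
    (hW : ∀ f ∈ W, SatisfiesRecurrence σ x y c f.1) :
    Module.Finite ℂ W ∧ Module.finrank ℂ W ≤ n := by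
  choose a ha hreg using exists_exp_eq_and_forall_ne_add_mul_succ (x := x) hσ.ne_zero
  let Ψ : W →ₗ[ℂ] (LocalIndex x → ℂ) := LinearMap.pi fun p =>
    lcoeff ℂ (p.2 : ℕ) ∘ₗ LinearMap.proj (a p.1) ∘ₗ (FormalLog σ).subtype ∘ₗ W.subtype
  have hinj : Function.Injective Ψ := by
    refine (injective_iff_map_eq_zero _).2 fun ⟨f, hfW⟩ hΨ => ?_
    have hrec := hW f hfW
    have hbase : ∀ A, f.1 (a A) = 0 := fun A => by
      ext r
      rcases lt_or_ge r (mult x A) with hr | hr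
      · exact congrFun hΨ ⟨A, ⟨r, hr⟩⟩
      · have hdeg := hrec.apply_mem_degreeLT_mult hσ.ne_zero A (ha A)
        rw [mem_degreeLT, degree_lt_iff_coeff_zero] at hdeg
        exact hdeg r hr
    refine Subtype.ext (Subtype.ext (funext fun b => ?_))
    by_cases hb : Complex.exp (twoPiI * b) ∈ expValues x
    · obtain ⟨i, -, hi⟩ := Finset.mem_image.1 hb
      refine hrec.apply_eq_zero_of_exp_eq hσ hc (hbase ⟨_, hb⟩) (hreg _) (fun j hj => ?_)
        (ha ⟨_, hb⟩).symm
      obtain ⟨k, hk⟩ := exp_twoPiI_mul_eq_iff.1 (hi.trans ((ha ⟨_, hb⟩).symm.trans hj.symm))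
      exact hxy i j k hk
    · exact hrec.apply_eq_zero_of_exp_notMem hσ.ne_zero hb
  refine ⟨Module.Finite.of_injective Ψ hinj, ?_⟩
  have hle := LinearMap.finrank_le_finrank_of_injective hinj
  rwa [Module.finrank_fintype_fun_eq_card, card_localIndex] at hle

variable {α β : Fin n → ℂ}

theorem finrank_formalSolutions_one_le (hαβ : ∀ (i j : Fin n) (k : ℤ), α i ≠ β j + (k : ℂ)) :
    Module.Finite ℂ (formalSolutions 1 α β) ∧ Module.finrank ℂ (formalSolutions 1 α β) ≤ n := by
  refine finrank_le_of_satisfiesRecurrence (c := (-1) ^ n) isUnit_one (by simp) hαβ _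
    fun f hf a => ?_
  rw [Int.cast_one, ← mem_formalSolutions_iff.1 hf a, smul_smul, ← mul_pow]
  simp

theorem finrank_formalSolutions_neg_one_le (hαβ : ∀ (i j : Fin n) (k : ℤ), α i ≠ β j + (k : ℂ)) :
    Module.Finite ℂ (formalSolutions (-1) α β) ∧
      Module.finrank ℂ (formalSolutions (-1) α β) ≤ n := by
  refine finrank_le_of_satisfiesRecurrence (x := β) (y := α) (c := (-1) ^ n) isUnit_one.neg
    (by simp) (fun i j k h => hαβ j i (-k) (by rw [h]; push_cast; ring)) _ fun f hf a => ?_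
  have hcoeff := mem_formalSolutions_iff.1 hf (a + 1)
  rw [add_sub_cancel_right] at hcoeff
  rw [Int.cast_neg, Int.cast_one, sub_neg_eq_add, hcoeff]

end Recurrence

/-! ### Bases of formal solutions -/

/-- Continuation of formal solutions along `k` positive turns around `0`; `formalMonodromy` is the
case `k = σ`. -/
def formalContinuation (σ k : ℤ) {n : ℕ} (α β : Fin n → ℂ) : Module.End ℂ (formalSolutions σ α β) :=
  (formalDeck σ k).restrict (mem_ker_of_commute
    (hypOp_commute (formalDeck_commute_D σ k) (formalDeck_commute_Z σ k) α β))

theorem formalContinuation_neg_mul (σ k : ℤ) {n : ℕ} (α β : Fin n → ℂ) :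
    formalContinuation σ (-k) α β * formalContinuation σ k α β = 1 := by
  refine LinearMap.ext fun f => Subtype.ext (Subtype.ext (funext fun a => ?_))
  change Complex.exp (twoPiI * (-k : ℤ) * a) • (Complex.exp (twoPiI * k * a) •
    (f.1.1 a).comp (X + C (twoPiI * k))).comp (X + C (twoPiI * (-k : ℤ))) = f.1.1 a
  rw [smul_comp, smul_smul, ← Complex.exp_add, comp_assoc]
  simp [add_assoc]

theorem IsLocalExponent.exists_basis_formalSolutions {σ : ℤ} {n : ℕ} {α β x : Fin n → ℂ}
    {ν : expValues x → ℂ} (hν : IsLocalExponent σ α β x ν) (hσ : IsUnit σ)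
    (hfin : Module.Finite ℂ (formalSolutions σ α β) ∧
      Module.finrank ℂ (formalSolutions σ α β) ≤ n) :
    ∃ b : Module.Basis (LocalIndex x) ℂ (formalSolutions σ α β),
      (∀ i, (b i : FormalLog σ) = formalSeries σ α β (ν i.1) (i.2 : ℕ)) ∧
      LinearMap.toMatrix b b (formalContinuation σ 1 α β) = (blockD x).transpose := by
  have := hfin.1
  let S : LocalIndex x → formalSolutions σ α β := fun q => ⟨_, hν.formalSeries_mem hσ q.2.2⟩
  have hT : ∀ q, formalContinuation σ 1 α β (S q) = ∑ p, blockD x q p • S p := fun q =>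
    Subtype.ext <| by
      rw [Submodule.coe_sum]
      exact hν.formalDeck_formalSeries hσ q
  have hS : ∀ (A : expValues x) (h : 0 < mult x A), S ⟨A, ⟨0, h⟩⟩ ≠ 0 := fun A _ h0 =>
    hν.formalSeries_zero_ne_zero A (congrArg Subtype.val h0)
  obtain ⟨b, hb, hM⟩ := exists_basis_of_blockD (x := x) (S := S) hfin.2 hT hS
  exact ⟨b, fun i => by rw [hb], hM⟩

/-! ### Sums of formal logarithmic series -/

theorem hasSumLocallyUniformlyOn_comp_equiv {ι κ X M : Type*} [TopologicalSpace X]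
    [AddCommMonoid M] [UniformSpace M] {f : ι → X → M} {g : X → M} {s : Set X}
    (h : HasSumLocallyUniformlyOn f g s) (e : κ ≃ ι) :
    HasSumLocallyUniformlyOn (fun k => f (e k)) g s := by
  intro U hU x hx
  obtain ⟨t, ht, hev⟩ := h U hU x hx
  have hmap : Filter.Tendsto (Finset.map e.toEmbedding) Filter.atTop Filter.atTop :=
    Filter.tendsto_atTop_atTop_of_monotone (Finset.mapEmbedding e.toEmbedding).monotone
      fun b => ⟨b.map e.symm.toEmbedding, by simp [Finset.map_map]⟩
  refine ⟨t, ht, (hmap.eventually hev).mono fun F hF y hy => ?_⟩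
  simpa using hF y hy

section Expansion

variable {σ : ℤ} {V : Opens ℂ}

/-- The value at `z = exp u` of the term with exponent `a` of a formal logarithmic series. -/
def logTerm (f : FormalLog σ) (a u : ℂ) : ℂ := Complex.exp (a * u) * (f.1 a).eval u

theorem differentiable_logTerm (f : FormalLog σ) (a : ℂ) : Differentiable ℂ (logTerm f a) :=
  Differentiable.fun_mul (by fun_prop) (f.1 a).differentiable

theorem logTerm_formalD (f : FormalLog σ) (a u : ℂ) :
    logTerm (formalD σ f) a u = deriv (logTerm f a) u := by
  have hexp : HasDerivAt (fun w : ℂ => Complex.exp (a * w)) (Complex.exp (a * u) * (a * 1)) u :=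
    ((hasDerivAt_id u).const_mul a).cexp
  rw [show logTerm f a = (fun w : ℂ => Complex.exp (a * w)) * fun w => (f.1 a).eval w from rfl,
    (hexp.mul ((f.1 a).hasDerivAt u)).deriv]
  change Complex.exp (a * u) * (a • f.1 a + derivative (f.1 a)).eval u = _
  rw [eval_add, eval_smul, smul_eq_mul]
  ring

theorem logTerm_formalZ (f : FormalLog σ) (a u : ℂ) :
    logTerm (formalZ σ f) a u = Complex.exp u * logTerm f (a - 1) u := by
  change Complex.exp (a * u) * (f.1 (a - 1)).eval u =
    Complex.exp u * (Complex.exp ((a - 1) * u) * (f.1 (a - 1)).eval u)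
  rw [← mul_assoc, ← Complex.exp_add]
  congr 2
  ring

theorem logTerm_formalDeck (k : ℤ) (f : FormalLog σ) (a u : ℂ) :
    logTerm (formalDeck σ k f) a u = logTerm f a (u + twoPiI * k) := by
  change Complex.exp (a * u) * (Complex.exp (twoPiI * k * a) •
    (f.1 a).comp (X + C (twoPiI * k))).eval u = _
  rw [eval_smul, smul_eq_mul, eval_comp, ← mul_assoc, ← Complex.exp_add, logTerm]
  simp only [eval_add, eval_X, eval_C]
  congr 2
  ring

/-- The pairs `(f, F)` such that the formal series `f` converges to the holomorphic function `F`,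
locally uniformly on `logCover V`. -/
def logExpansion (σ : ℤ) (V : Opens ℂ) : Submodule ℂ (FormalLog σ × Hol V) where
  carrier := {p | HasSumLocallyUniformlyOn (logTerm p.1) p.2.1 (logCover V)}
  zero_mem' := fun U hU u _ => ⟨Set.univ, Filter.univ_mem, .of_forall fun s w _ => by
    simpa [logTerm] using refl_mem_uniformity hU⟩
  add_mem' {p q} hp hq := by
    refine (TendstoLocallyUniformlyOn.add hp hq).congr fun s u _ => ?_
    simp [logTerm, mul_add, Finset.sum_add_distrib]
  smul_mem' c p hp := by
    refine ((uniformContinuous_const_smul c).comp_tendstoLocallyUniformlyOn hp).congr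
      fun s u _ => ?_
    simp [logTerm, Finset.mul_sum, mul_left_comm]

theorem Hol.ext_on {F G : Hol V} (h : ∀ u ∈ logCover V, F.1 u = G.1 u) : F = G := by
  refine Subtype.ext (funext fun u => ?_)
  by_cases hu : u ∈ logCover V
  · exact h u hu
  · rw [F.2.2 u hu, G.2.2 u hu]

theorem hasSum_of_mem_logExpansion {f : FormalLog σ} {F : Hol V} (h : (f, F) ∈ logExpansion σ V)
    {u : ℂ} (hu : u ∈ logCover V) : HasSum (fun a => logTerm f a u) (F.1 u) :=
  HasSumLocallyUniformlyOn.hasSum h hu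

theorem eq_of_mem_logExpansion {f : FormalLog σ} {F G : Hol V} (hF : (f, F) ∈ logExpansion σ V)
    (hG : (f, G) ∈ logExpansion σ V) : F = G :=
  Hol.ext_on fun _ hu =>
    (hasSum_of_mem_logExpansion hF hu).unique (hasSum_of_mem_logExpansion hG hu)

theorem formalD_holD_mem_logExpansion {f : FormalLog σ} {F : Hol V}
    (h : (f, F) ∈ logExpansion σ V) : (formalD σ f, holD V F) ∈ logExpansion σ V := by
  have hderiv := TendstoLocallyUniformlyOn.deriv h (.of_forall fun s =>
    (Differentiable.fun_sum fun a _ => differentiable_logTerm f a).differentiableOn)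
    (logCover V).2
  refine (hderiv.congr fun s u _ => ?_).congr_right fun u hu => (if_pos hu).symm
  simp only [Function.comp_apply, logTerm_formalD]
  exact deriv_fun_sum fun a _ => differentiable_logTerm f a u

theorem formalZ_holZ_mem_logExpansion {f : FormalLog σ} {F : Hol V}
    (h : (f, F) ∈ logExpansion σ V) : (formalZ σ f, holZ V F) ∈ logExpansion σ V := by
  have hshift := hasSumLocallyUniformlyOn_comp_equiv h (Equiv.subRight (1 : ℂ))
  have hexp : TendstoLocallyUniformlyOn (fun _ : Finset ℂ => Complex.exp) Complex.exp Filter.atTop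
      (logCover V) := fun U hU u _ =>
    ⟨Set.univ, Filter.univ_mem, .of_forall fun _ _ _ => refl_mem_uniformity hU⟩
  refine (hexp.mul₀ hshift Complex.continuous_exp.continuousOn F.2.1.continuousOn).congr
    fun s u _ => ?_
  simp [logTerm_formalZ, Finset.mul_sum]

theorem mem_holSolutions_of_mem_logExpansion {f : FormalLog σ} {F : Hol V}
    (h : (f, F) ∈ logExpansion σ V) {n : ℕ} {α β : Fin n → ℂ} (hf : f ∈ formalSolutions σ α β) :
    F ∈ holSolutions V α β := by
  have hD : ∀ q : ℂ[X], (aeval (formalD σ) q f, aeval (holD V) q F) ∈ logExpansion σ V := by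
    intro q
    let T : Module.End ℂ (FormalLog σ × Hol V) := (formalD σ).prodMap (holD V)
    have hq : aeval T q (f, F) ∈ logExpansion σ V :=
      aeval_apply_smul_mem_of_le_comap h q T fun p hp => formalD_holD_mem_logExpansion hp
    have hfst : (aeval T q (f, F)).1 = aeval (formalD σ) q f :=
      map_aeval_apply (LinearMap.fst ℂ _ _) (fun _ => rfl) q (f, F)
    have hsnd : (aeval T q (f, F)).2 = aeval (holD V) q F :=
      map_aeval_apply (LinearMap.snd ℂ _ _) (fun _ => rfl) q (f, F)
    rwa [← hfst, ← hsnd]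
  have hH : (hypOp (formalD σ) (formalZ σ) α β f, hypOp (holD V) (holZ V) α β F) ∈
      logExpansion σ V := by
    simpa only [hypOp, LinearMap.sub_apply, LinearMap.smul_apply, Module.End.mul_apply,
      Prod.smul_mk, Prod.mk_sub_mk] using (logExpansion σ V).sub_mem
        ((logExpansion σ V).smul_mem ((-1) ^ n) (hD (∏ i, (X - C (α i)))))
        (formalZ_holZ_mem_logExpansion (hD (∏ j, (X - C (β j)))))
  rw [LinearMap.mem_ker.1 hf] at hH
  exact LinearMap.mem_ker.2 (eq_of_mem_logExpansion hH (logExpansion σ V).zero_mem)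

theorem sum_smul_mem_logExpansion {ι : Type*} {f : ι → FormalLog σ} {F : ι → Hol V}
    (h : ∀ i, (f i, F i) ∈ logExpansion σ V) (s : Finset ι) (c : ι → ℂ) :
    (∑ i ∈ s, c i • f i, ∑ i ∈ s, c i • F i) ∈ logExpansion σ V := by
  have hsum := (logExpansion σ V).sum_mem (t := s) fun i _ =>
    (logExpansion σ V).smul_mem (c i) (h i)
  rwa [show ∑ i ∈ s, c i • (f i, F i) = (∑ i ∈ s, c i • f i, ∑ i ∈ s, c i • F i) from
    Prod.ext Prod.fst_sum Prod.snd_sum] at hsum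

theorem holDeck_eq_of_mem_logExpansion {k : ℤ} {f : FormalLog σ} {F G : Hol V}
    (hF : (f, F) ∈ logExpansion σ V) (hG : (formalDeck σ k f, G) ∈ logExpansion σ V) :
    holDeck V k F = G := by
  refine Hol.ext_on fun u hu => HasSum.unique ?_ (hasSum_of_mem_logExpansion hG hu)
  simp only [logTerm_formalDeck]
  exact hasSum_of_mem_logExpansion hF ((logCover_add V k u).2 hu)

open Classical in
theorem exists_mem_logExpansion {f : FormalLog σ}
    (hf : SummableLocallyUniformlyOn (logTerm f) (logCover V)) :
    ∃ F : Hol V, (f, F) ∈ logExpansion σ V := by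
  refine ⟨⟨fun u => if u ∈ logCover V then ∑' a, logTerm f a u else 0, ?_,
    fun u hu => if_neg hu⟩, hf.hasSumLocallyUniformlyOn.congr_right fun u hu => (if_pos hu).symm⟩
  exact (hf.differentiableOn (logCover V).2
    fun a u _ => differentiable_logTerm f a u).congr fun u hu => if_pos hu

end Expansion

section SeriesTerm

variable {σ : ℤ} {n : ℕ} {α β : Fin n → ℂ} {ν : ℂ} {r : ℕ}

theorem injective_add_intCast_mul_natCast (hσ : σ ≠ 0) (ν : ℂ) :
    Function.Injective fun l : ℕ => ν + (σ : ℂ) * l :=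
  (add_right_injective ν).comp
    ((mul_right_injective₀ (Int.cast_ne_zero.2 hσ)).comp Nat.cast_injective)

theorem logTerm_formalSeries (α β : Fin n → ℂ) (ν : ℂ) (r l : ℕ) (u : ℂ) :
    logTerm (formalSeries σ α β ν r) (ν + σ * l) u = seriesTerm σ α β ν r u l := by
  rw [logTerm, formalSeries_apply_add_mul_nat, seriesTerm_eq]

theorem logTerm_formalSeries_eq_zero {a : ℂ} (ha : a ∉ Set.range fun l : ℕ => ν + (σ : ℂ) * l)
    (u : ℂ) : logTerm (formalSeries σ α β ν r) a u = 0 := by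
  rw [logTerm, formalSeries_apply_of_forall_ne fun l hl => ha ⟨l, hl.symm⟩, eval_zero, mul_zero]

theorem hasSum_logTerm_formalSeries (hσ : σ ≠ 0) {u s : ℂ} :
    HasSum (fun a => logTerm (formalSeries σ α β ν r) a u) s ↔
      HasSum (seriesTerm σ α β ν r u) s := by
  rw [← (injective_add_intCast_mul_natCast hσ ν).hasSum_iff
    fun a ha => logTerm_formalSeries_eq_zero ha u]
  exact iff_of_eq (congrArg (HasSum · s) (funext fun l => logTerm_formalSeries α β ν r l u))

theorem seriesTerm_zero (σ : ℤ) (α β : Fin n → ℂ) (ν u : ℂ) (l : ℕ) :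
    seriesTerm σ α β ν 0 u l =
      Complex.exp (ν * u) * (gammaProd α β (ν + σ * l) * Complex.exp (σ * u) ^ l) := by
  simp only [seriesTerm, pow_zero, one_mul, iteratedDeriv_zero]
  rw [← Complex.exp_nat_mul, mul_left_comm, ← Complex.exp_add]
  ring_nf

theorem eq_zero_of_eventually_hasSum_zero {𝕜 : Type*} [NontriviallyNormedField 𝕜] {c : ℕ → 𝕜}
    (h : ∀ᶠ w in nhdsWithin (0 : 𝕜) {0}ᶜ, HasSum (fun l => c l * w ^ l) 0) : c = 0 := by
  have hp : HasFPowerSeriesAt (fun w => ∑' l, c l * w ^ l)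
      (FormalMultilinearSeries.ofScalars 𝕜 c) 0 := by
    rw [hasFPowerSeriesAt_iff]
    filter_upwards [eventually_nhdsWithin_iff.1 h] with w hw
    have hsum : Summable fun l => c l * w ^ l := by
      rcases eq_or_ne w 0 with rfl | hw0
      · exact summable_of_ne_finset_zero (s := {0}) fun l hl => by simp_all
      · exact (hw hw0).summable
    simpa [mul_comm] using hsum.hasSum
  have hzero : ∀ᶠ w in nhdsWithin (0 : 𝕜) {0}ᶜ, ∑' l, c l * w ^ l = 0 :=
    h.mono fun w hw => hw.tsum_eq
  have hcoeff := hp.eq_zero_of_eventually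
    (hp.analyticAt.frequently_zero_iff_eventually_zero.1 hzero.frequently)
  funext l
  rw [← FormalMultilinearSeries.coeff_ofScalars (𝕜 := 𝕜) (p := c), hcoeff]
  rfl

theorem gammaProd_eq_zero_of_mem_logExpansion {V : Opens ℂ} (hσ : σ ≠ 0)
    (hV : ∀ᶠ w in nhdsWithin (0 : ℂ) {0}ᶜ, ∀ u, Complex.exp (σ * u) = w → u ∈ logCover V)
    (h : (formalSeries σ α β ν 0, 0) ∈ logExpansion σ V) (l : ℕ) :
    gammaProd α β (ν + σ * l) = 0 := by
  refine congrFun (eq_zero_of_eventually_hasSum_zero (c := fun l => gammaProd α β (ν + σ * l)) ?_) l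
  filter_upwards [hV, self_mem_nhdsWithin] with w hw hw0
  have hu : Complex.exp (σ * (Complex.log w / σ)) = w := by
    rw [mul_div_cancel₀ _ (Int.cast_ne_zero.2 hσ), Complex.exp_log hw0]
  have hsum := (hasSum_logTerm_formalSeries hσ).1 (hasSum_of_mem_logExpansion h (hw _ hu))
  have hdiv := hsum.mul_left (Complex.exp (ν * (Complex.log w / σ)))⁻¹
  simpa only [seriesTerm_zero, hu, inv_mul_cancel_left₀ (Complex.exp_ne_zero _),
    Hol, Submodule.coe_zero, Pi.zero_apply, mul_zero] using hdiv

end SeriesTerm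

/-! ### Growth of the gamma product -/

section Growth

theorem exists_norm_le_mul_pow {X E : Type*} [SeminormedAddCommGroup E] {g : ℕ → X → E} {K : Set X}
    {q : ℝ} (hq : 0 < q) (hbdd : ∀ l, ∃ B, ∀ t ∈ K, ‖g l t‖ ≤ B)
    (hratio : ∀ᶠ l in Filter.atTop, ∀ t ∈ K, ‖g (l + 1) t‖ ≤ q * ‖g l t‖) :
    ∃ C, ∀ l, ∀ t ∈ K, ‖g l t‖ ≤ C * q ^ l := by
  choose B hB using hbdd
  obtain ⟨L, hL⟩ := Filter.eventually_atTop.1 hratio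
  refine ⟨∑ l ∈ Finset.range (L + 1), |B l| / q ^ l, fun l t ht => ?_⟩
  have hinit : ∀ l ≤ L, ‖g l t‖ ≤ (∑ l ∈ Finset.range (L + 1), |B l| / q ^ l) * q ^ l :=
    fun l hl => by
    rw [← div_le_iff₀ (pow_pos hq l)]
    calc ‖g l t‖ / q ^ l ≤ |B l| / q ^ l := by
          gcongr
          exact (hB l t ht).trans (le_abs_self _)
      _ ≤ _ := Finset.single_le_sum (f := fun l => |B l| / q ^ l) (fun _ _ => by positivity)
          (Finset.mem_range.2 (Nat.lt_succ_of_le hl))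
  rcases le_total l L with hl | hl
  · exact hinit l hl
  · induction l, hl using Nat.le_induction with
    | base => exact hinit L le_rfl
    | succ l hl ih =>
      calc ‖g (l + 1) t‖ ≤ q * ‖g l t‖ := hL l hl t ht
        _ ≤ q * (_ * q ^ l) := mul_le_mul_of_nonneg_left ih hq.le
        _ = _ * q ^ (l + 1) := by ring

theorem eventually_norm_natCast_add_le (c : ℝ) {q : ℝ} (hq : 1 < q) :
    ∀ᶠ l : ℕ in Filter.atTop, ∀ x y : ℂ, ‖x‖ ≤ c → ‖y‖ ≤ c →
      0 < ‖(l : ℂ) + x‖ ∧ ‖(l : ℂ) + y‖ ≤ q * ‖(l : ℂ) + x‖ := by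
  have hlarge := tendsto_natCast_atTop_atTop (R := ℝ)
  filter_upwards [hlarge.eventually_gt_atTop c,
    hlarge.eventually_gt_atTop (c * (1 + q) / (q - 1))] with l hc hcq x y hx hy
  rw [div_lt_iff₀ (sub_pos.2 hq)] at hcq
  have hlow : (l : ℝ) - c ≤ ‖(l : ℂ) + x‖ := by
    have := norm_sub_norm_le (l : ℂ) (-x)
    rw [norm_neg, Complex.norm_natCast, sub_neg_eq_add] at this
    linarith
  have hup : ‖(l : ℂ) + y‖ ≤ l + c := by
    have := norm_add_le (l : ℂ) y
    rw [Complex.norm_natCast] at this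
    linarith
  exact ⟨by linarith, by nlinarith⟩

theorem eventually_prod_norm_natCast_add_le {ι : Type*} [Fintype ι] (c : ℝ) {q : ℝ} (hq : 1 < q) :
    ∀ᶠ l : ℕ in Filter.atTop, ∀ x y : ι → ℂ, (∀ i, ‖x i‖ ≤ c) → (∀ i, ‖y i‖ ≤ c) →
      0 < ∏ i, ‖(l : ℂ) + x i‖ ∧ ∏ i, ‖(l : ℂ) + y i‖ ≤ q * ∏ i, ‖(l : ℂ) + x i‖ := by
  obtain ⟨q₀, hq₀q, hq₀⟩ : ∃ q₀ : ℝ, q₀ ^ Fintype.card ι < q ∧ 1 < q₀ := by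
    have hpow : Filter.Tendsto (fun y : ℝ => y ^ Fintype.card ι) (nhdsWithin 1 (Set.Ioi 1))
        (nhds (1 ^ Fintype.card ι)) :=
      ((continuous_pow _).tendsto 1).mono_left nhdsWithin_le_nhds
    rw [one_pow] at hpow
    exact ((hpow.eventually_lt_const hq).and self_mem_nhdsWithin).exists
  filter_upwards [eventually_norm_natCast_add_le c hq₀] with l hl x y hx hy
  have hpos : 0 < ∏ i, ‖(l : ℂ) + x i‖ := Finset.prod_pos fun i _ => (hl _ _ (hx i) (hy i)).1
  refine ⟨hpos, ?_⟩
  calc ∏ i, ‖(l : ℂ) + y i‖ ≤ ∏ i, q₀ * ‖(l : ℂ) + x i‖ :=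
        Finset.prod_le_prod (fun _ _ => norm_nonneg _) fun i _ => (hl _ _ (hx i) (hy i)).2
    _ = q₀ ^ Fintype.card ι * ∏ i, ‖(l : ℂ) + x i‖ := by
        rw [Finset.prod_mul_distrib, Finset.prod_const, Finset.card_univ]
    _ ≤ q * ∏ i, ‖(l : ℂ) + x i‖ := mul_le_mul_of_nonneg_right hq₀q.le hpos.le

variable {n : ℕ}

theorem exists_norm_gammaProd_natCast_add_le (α β : Fin n → ℂ) {K : Set ℂ} (hK : IsCompact K)
    {q : ℝ} (hq : 1 < q) :
    ∃ C, ∀ l : ℕ, ∀ t ∈ K, ‖gammaProd α β (l + t)‖ ≤ C * q ^ l := by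
  have hcont := (gammaProd_differentiable α β).continuous
  refine exists_norm_le_mul_pow (g := fun (l : ℕ) t => gammaProd α β (l + t)) (by linarith)
    (fun l => hK.exists_bound_of_continuousOn (by fun_prop)) ?_
  have hX : ∃ c, ∀ t ∈ K, ‖fun i => t + 1 - α i‖ ≤ c :=
    hK.exists_bound_of_continuousOn (by fun_prop)
  have hY : ∃ c, ∀ t ∈ K, ‖fun i => t - β i‖ ≤ c :=
    hK.exists_bound_of_continuousOn (by fun_prop)
  obtain ⟨c, hc⟩ := hX
  obtain ⟨c', hc'⟩ := hY
  filter_upwards [eventually_prod_norm_natCast_add_le (ι := Fin n) (max c c') hq] with l hl t ht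
  obtain ⟨hpos, hle⟩ := hl (fun i => t + 1 - α i) (fun i => t - β i)
    (fun i => ((norm_le_pi_norm (fun i => t + 1 - α i) i).trans (hc t ht)).trans (le_max_left _ _))
    (fun i => ((norm_le_pi_norm (fun i => t - β i) i).trans (hc' t ht)).trans (le_max_right _ _))
  have hrec : (∏ i, ‖(l : ℂ) + (t + 1 - α i)‖) * ‖gammaProd α β ((l + 1 : ℕ) + t)‖ =
      (∏ i, ‖(l : ℂ) + (t - β i)‖) * ‖gammaProd α β (l + t)‖ := by
    have hfun := congrArg norm (prod_sub_mul_gammaProd α β (l + t + 1))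
    rw [norm_mul, norm_mul, norm_mul, norm_pow, norm_neg, norm_one, one_pow, one_mul, norm_prod,
      norm_prod] at hfun
    rw [Nat.cast_succ, add_right_comm]
    simpa only [add_sub_assoc, add_assoc, add_sub_cancel, sub_self, add_zero] using hfun
  refine le_of_mul_le_mul_left ?_ hpos
  calc (∏ i, ‖(l : ℂ) + (t + 1 - α i)‖) * ‖gammaProd α β ((l + 1 : ℕ) + t)‖
      = (∏ i, ‖(l : ℂ) + (t - β i)‖) * ‖gammaProd α β (l + t)‖ := hrec
    _ ≤ (q * ∏ i, ‖(l : ℂ) + (t + 1 - α i)‖) * ‖gammaProd α β (l + t)‖ := by gcongr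
    _ = (∏ i, ‖(l : ℂ) + (t + 1 - α i)‖) * (q * ‖gammaProd α β (l + t)‖) := by ring

theorem exists_norm_gammaProd_intCast_mul_add_le {σ : ℤ} (hσ : IsUnit σ) (α β : Fin n → ℂ)
    {K : Set ℂ} (hK : IsCompact K) {q : ℝ} (hq : 1 < q) :
    ∃ C, ∀ l : ℕ, ∀ t ∈ K, ‖gammaProd α β (σ * l + t)‖ ≤ C * q ^ l := by
  rcases Int.isUnit_iff.1 hσ with rfl | rfl
  · simpa using exists_norm_gammaProd_natCast_add_le α β hK hq
  · obtain ⟨C, hC⟩ := exists_norm_gammaProd_natCast_add_le (-β) (-α) hK.neg hq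
    refine ⟨C, fun l t ht => ?_⟩
    rw [← gammaProd_neg, show -(((-1 : ℤ) : ℂ) * l + t) = l + -t by push_cast; ring]
    exact hC l (-t) (Set.neg_mem_neg.2 ht)

end Growth

section Convergence

variable {σ : ℤ} {n : ℕ} {α β : Fin n → ℂ} {ν : ℂ}

-- Cauchy's estimate on the circle of radius `1` around `ν` trades the derivatives in `t` for a
-- bound of `𝚪(σl + t) z ^ (σl + t)` itself.
theorem norm_seriesTerm_le {C q : ℝ} {l : ℕ}
    (hC : ∀ t ∈ Metric.sphere ν 1, ‖gammaProd α β (σ * l + t)‖ ≤ C * q ^ l) (r : ℕ) {u : ℂ}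
    {ρ M : ℝ} (hρ : ‖Complex.exp (σ * u)‖ ≤ ρ) (hM : ‖u‖ ≤ M) :
    ‖seriesTerm σ α β ν r u l‖ ≤
      ‖twoPiI⁻¹‖ ^ r * r.factorial * C * Real.exp ((‖ν‖ + 1) * M) * (q * ρ) ^ l := by
  have hbound : ∀ t ∈ Metric.sphere ν 1,
      ‖gammaProd α β (σ * l + t) * Complex.exp ((σ * l + t) * u)‖ ≤
        C * q ^ l * (ρ ^ l * Real.exp ((‖ν‖ + 1) * M)) := fun t ht => by
    have ht' : ‖t‖ ≤ ‖ν‖ + 1 := by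
      rw [mem_sphere_iff_norm] at ht
      linarith [norm_le_norm_add_norm_sub' t ν, norm_sub_rev t ν]
    rw [add_mul, mul_right_comm, mul_comm (_ * u), Complex.exp_add, Complex.exp_nat_mul, norm_mul,
      norm_mul, norm_pow]
    refine mul_le_mul (hC t ht) (mul_le_mul (by gcongr) ?_ (norm_nonneg _) ?_)
      (by positivity) ((norm_nonneg _).trans (hC t ht))
    · refine (Complex.norm_exp_le_exp_norm _).trans (Real.exp_le_exp.2 ?_)
      rw [norm_mul]
      gcongr
    · exact pow_nonneg ((norm_nonneg _).trans hρ) l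
  have hdiff : Differentiable ℂ fun t : ℂ =>
      gammaProd α β (σ * l + t) * Complex.exp ((σ * l + t) * u) :=
    ((gammaProd_differentiable α β).comp (by fun_prop)).fun_mul (by fun_prop)
  have hcauchy := Complex.norm_iteratedDeriv_le_of_forall_mem_sphere_norm_le r one_pos
    hdiff.diffContOnCl hbound
  rw [one_pow, div_one] at hcauchy
  rw [seriesTerm, norm_mul, norm_pow]
  refine (mul_le_mul_of_nonneg_left hcauchy (by positivity)).trans (le_of_eq ?_)
  rw [mul_pow]
  ring

theorem summableLocallyUniformlyOn_logTerm_formalSeries (hσ : IsUnit σ) (α β : Fin n → ℂ) (ν : ℂ)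
    (r : ℕ) {V : Opens ℂ} (hV : ∀ u ∈ logCover V, ‖Complex.exp (σ * u)‖ < 1) :
    SummableLocallyUniformlyOn (logTerm (formalSeries σ α β ν r)) (logCover V) := by
  refine SummableLocallyUniformlyOn_of_locally_bounded (logCover V).2 fun K hKV hK => ?_
  obtain ⟨M, hM⟩ := hK.exists_bound_of_continuousOn continuous_id.continuousOn
  obtain ⟨ρ, hρ0, hρ1, hρ⟩ : ∃ ρ : ℝ, 0 ≤ ρ ∧ ρ < 1 ∧ ∀ u ∈ K, ‖Complex.exp (σ * u)‖ ≤ ρ := by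
    rcases K.eq_empty_or_nonempty with rfl | hne
    · exact ⟨0, le_rfl, one_pos, by simp⟩
    · obtain ⟨v, hv, hmax⟩ := hK.exists_isMaxOn hne
        (f := fun u => ‖Complex.exp (σ * u)‖) (by fun_prop)
      exact ⟨_, norm_nonneg _, hV v (hKV hv), hmax⟩
  obtain ⟨C, hC⟩ := exists_norm_gammaProd_intCast_mul_add_le hσ α β (isCompact_sphere ν 1)
    (q := 2 / (1 + ρ)) (by rw [one_lt_div₀ (by linarith)]; linarith)
  have hb := (summable_geometric_of_lt_one (r := 2 / (1 + ρ) * ρ) (by positivity) (by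
    rw [div_mul_eq_mul_div, div_lt_one (by linarith)]; linarith)).mul_left
      (‖twoPiI⁻¹‖ ^ r * r.factorial * C * Real.exp ((‖ν‖ + 1) * M))
  have hinj := injective_add_intCast_mul_natCast hσ.ne_zero ν
  refine ⟨_, ((hasSum_extend_zero hinj).2 hb.hasSum).summable, fun a u hu => ?_⟩
  by_cases ha : a ∈ Set.range fun l : ℕ => ν + (σ : ℂ) * l
  · obtain ⟨l, rfl⟩ := ha
    rw [hinj.extend_apply, logTerm_formalSeries]
    exact norm_seriesTerm_le (hC l) r (hρ u hu) (hM u hu)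
  · rw [logTerm_formalSeries_eq_zero ha, norm_zero, Function.extend_apply' _ _ _ ha]
    rfl

end Convergence

/-! ### The dimension of the space of holomorphic solutions -/

theorem eq_zero_of_forall_exists_degree_eq {K M : Type*} [Field K] [AddCommGroup M] [Module K M]
    {φ : K[X] →ₗ[K] M} (h : ∀ m : ℕ, ∃ q : K[X], q.degree = m ∧ φ q = 0) : φ = 0 := by
  choose q hdeg hq using h
  let S : Sequence K := ⟨q, hdeg⟩
  exact LinearMap.ext_on_range (v := S)
    (S.span fun m => (leadingCoeff_ne_zero.2 (S.ne_zero m)).isUnit) hq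

section Jets

variable {V : Opens ℂ} {n : ℕ} {α β : Fin n → ℂ} {u : ℂ}

theorem monic_natDegree_X_add_C_pow_mul_prod (c : ℂ) (k : ℕ) (x : Fin n → ℂ) :
    ((X + C c) ^ k * ∏ i, (X - C (x i))).Monic ∧
      ((X + C c) ^ k * ∏ i, (X - C (x i))).natDegree = n + k := by
  have hpow : ((X + C c : ℂ[X]) ^ k).Monic := (monic_X_add_C c).pow k
  have hprod : (∏ i, (X - C (x i))).Monic := monic_prod_of_monic _ _ fun i _ => monic_X_sub_C _
  refine ⟨hpow.mul hprod, ?_⟩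
  rw [hpow.natDegree_mul hprod, (monic_X_add_C c).natDegree_pow, natDegree_X_add_C]
  simp [add_comm]

theorem semiconjBy_holZ : SemiconjBy (holZ V) (holD V + 1) (holD V) := by
  refine LinearMap.ext fun F => Hol.ext_on fun u hu => ?_
  have hD : ∀ G : Hol V, (holD V G).1 u = deriv G.1 u := fun G => if_pos hu
  change Complex.exp u * ((holD V F).1 u + F.1 u) = (holD V (holZ V F)).1 u
  rw [hD, hD]
  change _ = deriv (fun w => Complex.exp w * F.1 w) u
  rw [deriv_fun_mul Complex.differentiableAt_exp (Hol.differentiableAt F hu), Complex.deriv_exp]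
  ring

theorem holD_pow_apply (F : Hol V) (m : ℕ) (hu : u ∈ logCover V) :
    ((holD V ^ m) F).1 u = iteratedDeriv m F.1 u := by
  induction m generalizing u with
  | zero => rw [pow_zero, Module.End.one_apply, iteratedDeriv_zero]
  | succ m ih =>
    rw [pow_succ', Module.End.mul_apply, iteratedDeriv_succ]
    refine (if_pos hu).trans (Filter.EventuallyEq.deriv_eq ?_)
    filter_upwards [(logCover V).2.mem_nhds hu] with w hw using ih hw

/-- The jet of `F` at `u`, as the functional `p ↦ (p(D) F)(u)` on polynomials. -/
def jet (V : Opens ℂ) (u : ℂ) : Hol V →ₗ[ℂ] Module.Dual ℂ ℂ[X] :=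
  (LinearMap.llcomp ℂ (Hol V) (Hol V) ℂ (LinearMap.proj u ∘ₗ (Hol V).subtype) ∘ₗ
    (aeval (holD V)).toLinearMap).flip

theorem jet_apply (F : Hol V) (p : ℂ[X]) : jet V u F p = (aeval (holD V) p F).1 u := rfl

theorem jet_eq_of_mem_holSolutions {F : Hol V} (hF : F ∈ holSolutions V α β) (u : ℂ) (k : ℕ) :
    jet V u F ((-1 : ℂ) ^ n • (X ^ k * ∏ i, (X - C (α i))) -
      Complex.exp u • ((X + 1) ^ k * ∏ j, (X - C (β j)))) = 0 := by
  have hpow := congrArg (fun T : Module.End ℂ (Hol V) => T (aeval (holD V) (∏ j, (X - C (β j))) F))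
    (semiconjBy_holZ.pow_right k).eq
  have hsol := congrArg (holD V ^ k) (LinearMap.mem_ker.1 hF)
  rw [hypOp, LinearMap.sub_apply, LinearMap.smul_apply, map_sub, map_smul, Module.End.mul_apply,
    ← Module.End.mul_apply (holD V ^ k) (holZ V), ← hpow, map_zero] at hsol
  rw [jet_apply, map_sub, map_smul, map_smul, map_mul, map_mul, map_pow, map_pow, map_add, map_one,
    aeval_X]
  exact congrArg (fun G : Hol V => G.1 u) hsol

theorem jet_eq_zero_of_mem_holSolutions {F : Hol V} (hF : F ∈ holSolutions V α β)
    (hu : (-1) ^ n - Complex.exp u ≠ 0) (h0 : ∀ m < n, jet V u F (X ^ m) = 0) : jet V u F = 0 := by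
  refine eq_zero_of_forall_exists_degree_eq fun m => ?_
  rcases lt_or_ge m n with hm | hm
  · exact ⟨X ^ m, degree_X_pow m, h0 m hm⟩
  obtain ⟨k, rfl⟩ := Nat.exists_eq_add_of_le hm
  refine ⟨_, ?_, jet_eq_of_mem_holSolutions hF u k⟩
  obtain ⟨hmα, hdα⟩ := monic_natDegree_X_add_C_pow_mul_prod 0 k α
  obtain ⟨hmβ, hdβ⟩ := monic_natDegree_X_add_C_pow_mul_prod 1 k β
  rw [C_0, add_zero] at hmα hdα
  rw [C_1] at hmβ hdβ
  have hα := hmα.coeff_natDegree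
  have hβ := hmβ.coeff_natDegree
  rw [hdα] at hα
  rw [hdβ] at hβ
  refine degree_eq_of_le_of_coeff_ne_zero ?_ ?_
  · refine (degree_sub_le _ _).trans (max_le ?_ ?_) <;> refine (degree_smul_le _ _).trans ?_
    · exact degree_le_of_natDegree_le hdα.le
    · exact degree_le_of_natDegree_le hdβ.le
  · simpa only [coeff_sub, coeff_smul, hα, hβ, smul_eq_mul, mul_one] using hu

theorem eq_zero_of_jet_eq_zero (hV : IsPreconnected (logCover V : Set ℂ)) {F : Hol V}
    (hu : u ∈ logCover V) (h : jet V u F = 0) : F = 0 := by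
  have hF : AnalyticOnNhd ℂ F.1 (logCover V) := F.2.1.analyticOnNhd (logCover V).2
  have hderiv : ∀ m, iteratedDeriv m F.1 u = 0 := fun m => by
    rw [← holD_pow_apply F m hu, ← aeval_X_pow (R := ℂ) (holD V), ← jet_apply, h,
      LinearMap.zero_apply]
  have horder : analyticOrderAt F.1 u = ⊤ := ENat.eq_top_iff_forall_ge.2 fun m =>
    (natCast_le_analyticOrderAt_iff_iteratedDeriv_eq_zero (hF u hu)).2 fun i _ => hderiv i
  exact Hol.ext_on fun w hw => hF.eqOn_zero_of_preconnected_of_eventuallyEq_zero hV hu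
    (analyticOrderAt_eq_top.1 horder) hw

theorem finrank_holSolutions_le (hV : IsPreconnected (logCover V : Set ℂ)) (hu : u ∈ logCover V)
    (hu0 : (-1) ^ n - Complex.exp u ≠ 0) (α β : Fin n → ℂ) :
    Module.Finite ℂ (holSolutions V α β) ∧ Module.finrank ℂ (holSolutions V α β) ≤ n := by
  let Ψ : holSolutions V α β →ₗ[ℂ] (Fin n → ℂ) := LinearMap.pi fun m =>
    LinearMap.applyₗ (X ^ (m : ℕ)) ∘ₗ jet V u ∘ₗ (holSolutions V α β).subtype
  have hinj : Function.Injective Ψ := (injective_iff_map_eq_zero _).2 fun F hF => Subtype.ext <|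
    eq_zero_of_jet_eq_zero hV hu
      (jet_eq_zero_of_mem_holSolutions F.2 hu0 fun m hm => congrFun hF ⟨m, hm⟩)
  refine ⟨Module.Finite.of_injective Ψ hinj, ?_⟩
  have hle := LinearMap.finrank_le_finrank_of_injective hinj
  rwa [Module.finrank_fin_fun] at hle

end Jets

/-! ### Bases of holomorphic solutions -/

theorem pow_neg_one_sub_exp_ne_zero {σ : ℤ} {u : ℂ} (hu : ‖Complex.exp (σ * u)‖ < 1) (n : ℕ) :
    (-1) ^ n - Complex.exp u ≠ 0 := fun h => by
  rw [Complex.exp_int_mul, ← sub_eq_zero.1 h] at hu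
  simp at hu

theorem IsLocalExponent.exists_basis_holSolutions {σ : ℤ} {n : ℕ} {α β x : Fin n → ℂ}
    {ν : expValues x → ℂ} {V : Opens ℂ} (hν : IsLocalExponent σ α β x ν) (hσ : IsUnit σ)
    (hV : IsPreconnected (logCover V : Set ℂ)) (hlt : ∀ u ∈ logCover V, ‖Complex.exp (σ * u)‖ < 1)
    (hnear : ∀ᶠ w in nhdsWithin (0 : ℂ) {0}ᶜ, ∀ u, Complex.exp (σ * u) = w → u ∈ logCover V) :
    ∃ b : Module.Basis (LocalIndex x) ℂ (holSolutions V α β),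
      (∀ i, ∀ u ∈ logCover V,
        HasSum (seriesTerm σ α β (ν i.1) (i.2 : ℕ) u) ((b i : Hol V).1 u)) ∧
      LinearMap.toMatrix b b (holMonodromy V 1 α β) = (blockD x).transpose := by
  choose F hF using fun q : LocalIndex x => exists_mem_logExpansion
    (summableLocallyUniformlyOn_logTerm_formalSeries hσ α β (ν q.1) q.2 hlt)
  obtain ⟨w, hw, hw0⟩ := (hnear.and self_mem_nhdsWithin).exists
  have hu : Complex.log w / σ ∈ logCover V := hw _ <| by
    rw [mul_div_cancel₀ _ (Int.cast_ne_zero.2 hσ.ne_zero), Complex.exp_log hw0]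
  have hfin := finrank_holSolutions_le hV hu (pow_neg_one_sub_exp_ne_zero (hlt _ hu) n) α β
  have := hfin.1
  let S : LocalIndex x → holSolutions V α β := fun q =>
    ⟨F q, mem_holSolutions_of_mem_logExpansion (hF q) (hν.formalSeries_mem hσ q.2.2)⟩
  have hT : ∀ q, holMonodromy V 1 α β (S q) = ∑ p, blockD x q p • S p := fun q => by
    refine Subtype.ext (.trans (b := ∑ p, blockD x q p • F p) ?_ ?_)
    · refine holDeck_eq_of_mem_logExpansion (hF q) ?_
      rw [hν.formalDeck_formalSeries hσ q]
      exact sum_smul_mem_logExpansion hF Finset.univ (blockD x q)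
    · rw [Submodule.coe_sum]
      rfl
  have hS : ∀ (A : expValues x) (h : 0 < mult x A), S ⟨A, ⟨0, h⟩⟩ ≠ 0 := fun A h h0 => by
    obtain ⟨l, hl⟩ := hν.exists_ne_zero A
    have hzero := hF ⟨A, ⟨0, h⟩⟩
    rw [show F ⟨A, ⟨0, h⟩⟩ = 0 from congrArg Subtype.val h0] at hzero
    exact hl (gammaProd_eq_zero_of_mem_logExpansion hσ.ne_zero hnear hzero l)
  obtain ⟨b, hb, hM⟩ := exists_basis_of_blockD (x := x) (S := S) hfin.2 hT hS
  refine ⟨b, fun i u hu => ?_, hM⟩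
  rw [hb]
  exact (hasSum_logTerm_formalSeries hσ.ne_zero).1 (hasSum_of_mem_logExpansion (hF i) hu)

theorem holMonodromy_neg_mul (V : Opens ℂ) (k : ℤ) {n : ℕ} (α β : Fin n → ℂ) :
    holMonodromy V (-k) α β * holMonodromy V k α β = 1 := by
  refine LinearMap.ext fun F => Subtype.ext (Subtype.ext (funext fun u => ?_))
  change F.1.1 (u + twoPiI * (-k : ℤ) + twoPiI * k) = F.1.1 u
  rw [Int.cast_neg, mul_neg, neg_add_cancel_right]

theorem toMatrix_eq_inv_of_mul_eq_one {ι R M : Type*} [Fintype ι] [DecidableEq ι] [CommRing R]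
    [AddCommMonoid M] [Module R M] (b : Module.Basis ι R M) {S T : Module.End R M} (h : S * T = 1) :
    LinearMap.toMatrix b b S = (LinearMap.toMatrix b b T)⁻¹ := by
  refine (Matrix.inv_eq_left_inv ?_).symm
  rw [← LinearMap.toMatrix_mul, h, LinearMap.toMatrix_one]

section Discs

theorem mem_logCover_discZero {ρ : ℝ} {u : ℂ} :
    u ∈ logCover (discZero ρ) ↔ ‖Complex.exp u‖ < ρ :=
  and_iff_right (norm_pos_iff.2 (Complex.exp_ne_zero u))

theorem mem_logCover_discInfty {R : ℝ} {u : ℂ} :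
    u ∈ logCover (discInfty R) ↔ R < ‖Complex.exp u‖ := Iff.rfl

theorem isPreconnected_logCover_discZero {ρ : ℝ} (hρ : 0 < ρ) :
    IsPreconnected (logCover (discZero ρ) : Set ℂ) := by
  have hset : (logCover (discZero ρ) : Set ℂ) = {u | u.re < Real.log ρ} := Set.ext fun u => by
    rw [SetLike.mem_coe, mem_logCover_discZero, Complex.norm_exp, Set.mem_ofPred_eq,
      Real.lt_log_iff_exp_lt hρ]
  rw [hset]
  exact (convex_halfSpace_re_lt _).isPreconnected

theorem isPreconnected_logCover_discInfty {R : ℝ} (hR : 0 < R) :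
    IsPreconnected (logCover (discInfty R) : Set ℂ) := by
  have hset : (logCover (discInfty R) : Set ℂ) = {u | Real.log R < u.re} := Set.ext fun u => by
    rw [SetLike.mem_coe, mem_logCover_discInfty, Complex.norm_exp, Set.mem_ofPred_eq,
      Real.log_lt_iff_lt_exp hR]
  rw [hset]
  exact (convex_halfSpace_re_gt _).isPreconnected

variable {n : ℕ} {α β x : Fin n → ℂ} {ν : expValues x → ℂ}

theorem IsLocalExponent.exists_basis_holSolutions_discZero (hν : IsLocalExponent 1 α β x ν) {ρ : ℝ}
    (hρ : 0 < ρ) (hρ1 : ρ ≤ 1) :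
    ∃ b : Module.Basis (LocalIndex x) ℂ (holSolutions (discZero ρ) α β),
      (∀ i, ∀ u ∈ logCover (discZero ρ),
        HasSum (seriesTerm 1 α β (ν i.1) (i.2 : ℕ) u) ((b i : Hol (discZero ρ)).1 u)) ∧
      LinearMap.toMatrix b b (holMonodromy (discZero ρ) 1 α β) = (blockD x).transpose := by
  refine hν.exists_basis_holSolutions isUnit_one (isPreconnected_logCover_discZero hρ)
    (fun u hu => ?_) ?_
  · rw [Int.cast_one, one_mul]
    exact (mem_logCover_discZero.1 hu).trans_le hρ1
  · filter_upwards [nhdsWithin_le_nhds (Metric.ball_mem_nhds 0 hρ)] with w hw u hu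
    rw [mem_ball_zero_iff, ← hu, Int.cast_one, one_mul] at hw
    exact mem_logCover_discZero.2 hw

theorem IsLocalExponent.exists_basis_holSolutions_discInfty (hν : IsLocalExponent (-1) α β x ν)
    {R : ℝ} (hR : 1 ≤ R) :
    ∃ b : Module.Basis (LocalIndex x) ℂ (holSolutions (discInfty R) α β),
      (∀ i, ∀ u ∈ logCover (discInfty R),
        HasSum (seriesTerm (-1) α β (ν i.1) (i.2 : ℕ) u) ((b i : Hol (discInfty R)).1 u)) ∧
      LinearMap.toMatrix b b (holMonodromy (discInfty R) 1 α β) = (blockD x).transpose := by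
  have hR0 : 0 < R := one_pos.trans_le hR
  have hnorm : ∀ u : ℂ, ‖Complex.exp ((-1 : ℤ) * u)‖ = ‖Complex.exp u‖⁻¹ := fun u => by
    rw [Int.cast_neg, Int.cast_one, neg_one_mul, Complex.exp_neg, norm_inv]
  refine hν.exists_basis_holSolutions isUnit_one.neg (isPreconnected_logCover_discInfty hR0)
    (fun u hu => ?_) ?_
  · rw [hnorm]
    exact inv_lt_one_of_one_lt₀ (hR.trans_lt (mem_logCover_discInfty.1 hu))
  · filter_upwards [nhdsWithin_le_nhds (Metric.ball_mem_nhds 0 (inv_pos.2 hR0))] with w hw u hu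
    rw [mem_ball_zero_iff, ← hu, hnorm,
      inv_lt_inv₀ (norm_pos_iff.2 (Complex.exp_ne_zero u)) hR0] at hw
    exact mem_logCover_discInfty.2 hw

end Discs

end Hypergeom

end

theorem mainTheorem9 {n : ℕ} (α β : Fin n → ℂ)
    (hαβ : ∀ (i j : Fin n) (k : ℤ), α i ≠ β j + (k : ℂ)) :
    -- formal solutions at 0 and their monodromy
    (∃ b : Module.Basis (Hypergeom.LocalIndex α) ℂ (Hypergeom.formalSolutions 1 α β),
      (∀ i, (b i : Hypergeom.FormalLog 1) =
        Hypergeom.formalSeries 1 α β (Hypergeom.nuMin α i.1) (i.2 : ℕ)) ∧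
      LinearMap.toMatrix b b (Hypergeom.formalMonodromy 1 α β) =
        (Hypergeom.blockD α).transpose) ∧
    -- the series converge for 0 < |z| < 1; analytic solutions near 0 and their monodromy
    (∀ ρ : ℝ, 0 < ρ → ρ ≤ 1 →
      ∃ b : Module.Basis (Hypergeom.LocalIndex α) ℂ
          (Hypergeom.holSolutions (Hypergeom.discZero ρ) α β),
        (∀ i, ∀ u ∈ Hypergeom.logCover (Hypergeom.discZero ρ),
          HasSum (Hypergeom.seriesTerm 1 α β (Hypergeom.nuMin α i.1) (i.2 : ℕ) u)
            ((b i : Hypergeom.Hol (Hypergeom.discZero ρ)).1 u)) ∧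
        LinearMap.toMatrix b b (Hypergeom.holMonodromy (Hypergeom.discZero ρ) 1 α β) =
          (Hypergeom.blockD α).transpose) ∧
    -- formal solutions at infinity and their monodromy
    (∃ b : Module.Basis (Hypergeom.LocalIndex β) ℂ (Hypergeom.formalSolutions (-1) α β),
      (∀ i, (b i : Hypergeom.FormalLog (-1)) =
        Hypergeom.formalSeries (-1) α β (Hypergeom.nuMax β i.1) (i.2 : ℕ)) ∧
      LinearMap.toMatrix b b (Hypergeom.formalMonodromy (-1) α β) =
        (Hypergeom.blockD β).transpose⁻¹) ∧
    -- the series converge for |z| > 1; analytic solutions near infinity and their monodromy,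
    -- a positive turn around infinity being a negative turn around 0
    (∀ R : ℝ, 1 ≤ R →
      ∃ b : Module.Basis (Hypergeom.LocalIndex β) ℂ
          (Hypergeom.holSolutions (Hypergeom.discInfty R) α β),
        (∀ i, ∀ u ∈ Hypergeom.logCover (Hypergeom.discInfty R),
          HasSum (Hypergeom.seriesTerm (-1) α β (Hypergeom.nuMax β i.1) (i.2 : ℕ) u)
            ((b i : Hypergeom.Hol (Hypergeom.discInfty R)).1 u)) ∧
        LinearMap.toMatrix b b (Hypergeom.holMonodromy (Hypergeom.discInfty R) (-1) α β) =
          (Hypergeom.blockD β).transpose⁻¹) := by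
  have h0 := Hypergeom.isLocalExponent_nuMin hαβ
  have hinf := Hypergeom.isLocalExponent_nuMax hαβ
  refine ⟨h0.exists_basis_formalSolutions isUnit_one (Hypergeom.finrank_formalSolutions_one_le hαβ),
    fun ρ hρ hρ1 => h0.exists_basis_holSolutions_discZero hρ hρ1, ?_, fun R hR => ?_⟩
  · obtain ⟨b, hb, hM⟩ := hinf.exists_basis_formalSolutions isUnit_one.neg
      (Hypergeom.finrank_formalSolutions_neg_one_le hαβ)
    refine ⟨b, hb, ?_⟩
    rw [← hM]
    exact Hypergeom.toMatrix_eq_inv_of_mul_eq_one b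
      (Hypergeom.formalContinuation_neg_mul (-1) 1 α β)
  · obtain ⟨b, hb, hM⟩ := hinf.exists_basis_holSolutions_discInfty hR
    refine ⟨b, hb, ?_⟩
    rw [← hM]
    exact Hypergeom.toMatrix_eq_inv_of_mul_eq_one b (Hypergeom.holMonodromy_neg_mul _ 1 α β)
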